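/- **Setting.** Let $V_0=\mathbb N$ (a set of urelements), $V_{n+1}=V_n\cup\mathcal P(V_n)$ and $V=\bigcup_{n\in\omega}V_n$. A nonstandard universe $({}^*V,{}^*\!\in)$ is the truncation at ${}^*\!\in$-rank $\omega$ (that is, the collection of all objects that are ${}^*\!\in$-members of ${}^*V_n$ for some standard $n$) of an elementary extension of $(V,\in)$ such that ${}^*\mathbb N\smallsetminus\mathbb N\neq\emptyset$. It is called $\lambda$-saturated if every family of fewer than $\lambda$ internal sets with the finite intersection property has nonempty intersection. For $H\in{}^*\mathbb N\smallsetminus\mathbb N$ let $\Omega=\{1,2,\ldots,H\}$, let ${}^*\mathcal P(\Omega)$ be the algebra of all internal subsets of $\Omega$, and let $P(A)={}^*|A|/H$ for $A\in{}^*\mathcal P(\Omega)$, where ${}^*|A|$ is the internal cardinality of $A$. The hyperfinite Loeb space $(\Omega,\Sigma,L_P)$ is the complete countably additive probability space obtained from $(\Omega,{}^*\mathcal P(\Omega),\mathrm{st}\circ P)$ by the Carathéodory extension. A probability space $(\Omega,\Sigma,P)$ is called compact if there is a family $\mathcal C\subseteq\Sigma$ such that every $\mathcal D\subseteq\mathcal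 C$ with the finite intersection property satisfies $\bigcap\mathcal D\neq\emptyset$, and such that $P(A)=\sup\{P(C):C\in\mathcal C,\ C\subseteq A\}$ for every $A\in\Sigma$. **Theorem 8.** Let $\kappa$ be a strong limit cardinal of cofinality $\omega$, and suppose $\lambda=\kappa^+=2^\kappa$. If ${}^*V$ is a $\lambda$-saturated nonstandard universe and $|{}^*\mathbb N|=\lambda$, then every hyperfinite Loeb space in ${}^*V$ is compact. -/

import Mathlib

open Cardinal MeasureTheory
open scoped ENNReal

universe u

namespace LoebCompact

/-! ## The standard universe: the superstructure over the urelements `ℕ` -/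

/-- `Level n` is the `n`-th stage `V_n` of the superstructure over the urelements `ℕ`:
`V_0 = ℕ`, and every element of `V_{n+1} = V_n ∪ 𝒫(V_n)` is an urelement or a subset of `V_n`
(disjointly, as an urelement is not a set). -/
def Level : ℕ → Type
  | 0 => ℕ
  | n + 1 => ℕ ⊕ Set (Level n)

namespace Level

/-- The urelement `k`, seen in `V_n`. -/
def atom : ∀ n : ℕ, ℕ → Level n
  | 0, k => k
  | _ + 1, k => Sum.inl k

/-- A subset of `V_n` as an element of `V_{n+1}`. -/
def set {n : ℕ} (s : Set (Level n)) : Level (n + 1) := Sum.inr s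

/-- The inclusion `V_n ⊆ V_{n+1}`. -/
def lift : ∀ n : ℕ, Level n → Level (n + 1)
  | 0 => fun k => Sum.inl k
  | n + 1 => Sum.map id (Set.image (lift n))

/-- The Kuratowski pair `{{x}, {x, y}}` of two elements of `V_n`. -/
def pair {n : ℕ} (x y : Level n) : Level (n + 2) := set {set {x}, set {x, y}}

end Level

/-- The standard universe `V = ⋃ₙ V_n` (the direct limit along the inclusions `V_n ⊆ V_{n+1}`). -/
def V : Type :=
  Quot fun a b : Σ n, Level n => b = ⟨a.1 + 1, Level.lift a.1 a.2⟩

namespace V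

/-- The element of `V` given by an element of the stage `V_n`. -/
def of (n : ℕ) (x : Level n) : V := Quot.mk _ ⟨n, x⟩

/-- The membership relation of the standard universe; urelements have no members. -/
def Mem (x y : V) : Prop :=
  ∃ (n : ℕ) (a : Level n) (s : Set (Level n)), a ∈ s ∧ x = of n a ∧ y = of (n + 1) (Level.set s)

/-- The natural number `k`, as an urelement. -/
def nat (k : ℕ) : V := of 0 (Level.atom 0 k)

/-- The stage `V_n` as an element of `V`. -/
def stage (n : ℕ) : V := of (n + 1) (Level.set Set.univ)

/-- The set `ℕ = V_0` as an element of `V`. -/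
def natSet : V := stage 0

/-- The order `{(a, b) : a ≤ b}` of `ℕ` as an element of `V`. -/
def leGraph : V :=
  of 3 (Level.set {p | ∃ a b : ℕ, a ≤ b ∧ p = Level.pair (Level.atom 0 a) (Level.atom 0 b)})

/-- The multiplication `{((a, b), a * b)}` of `ℕ` as an element of `V`. -/
def mulGraph : V :=
  of 5 (Level.set {p | ∃ a b : ℕ,
    p = Level.pair (Level.pair (Level.atom 0 a) (Level.atom 0 b)) (Level.atom 2 (a * b))})

/-- The cardinality function `{(A, |A|) : A a finite subset of ℕ}` as an element of `V`. -/
def cardGraph : V :=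
  of 4 (Level.set {p | ∃ A : Finset ℕ,
    p = Level.pair (Level.set {x | ∃ a ∈ A, x = Level.atom 0 a}) (Level.atom 1 A.card)})

end V

/-! ## Nonstandard universes -/

/-- The relation symbols of the language of set theory: one binary symbol. -/
inductive MemRel : ℕ → Type
  | mem : MemRel 2

/-- The first-order language `{∈}` of set theory. -/
def memLang : FirstOrder.Language := ⟨fun _ => Empty, MemRel⟩

/-- The symbol `∈` of the language. -/
def memSymb : memLang.Relations 2 := MemRel.mem

/-- A type with a binary relation as a structure for the language `{∈}`. -/
@[reducible] def memStructure {M : Type*} (E : M → M → Prop) : memLang.Structure M where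
  funMap := fun f => f.elim
  RelMap := fun {_} r => match r with
    | MemRel.mem => fun x => E (x 0) (x 1)

/-- The membership relation of a structure for the language `{∈}`. -/
def memOf {M : Type*} [memLang.Structure M] (x y : M) : Prop :=
  FirstOrder.Language.Structure.RelMap memSymb ![x, y]

instance : memLang.Structure V := memStructure V.Mem

/-- A nonstandard universe is presented by an elementary extension `W` of the standard universe
`(V, ∈)` in which `*ℕ` has a nonstandard element; the nonstandard universe `*V` itself is the
truncation `NonstandardUniverse.Obj` of `W`. -/
structure NonstandardUniverse where
  /-- The elementary extension, before truncation. -/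
  W : Type u
  /-- Its structure for the language `{∈}`, that is, its membership relation. -/
  str : memLang.Structure W
  /-- The elementary embedding of the standard universe. -/
  emb : FirstOrder.Language.ElementaryEmbedding memLang V W
  /-- `*ℕ ∖ ℕ` is not empty. -/
  exists_nonstandard : ∃ x : W, memOf x (emb V.natSet) ∧ ∀ n : ℕ, x ≠ emb (V.nat n)

attribute [instance] NonstandardUniverse.str

/-- Every element of the standard universe lies in some stage. -/
theorem V.exists_mem_stage (x : V) : ∃ n, V.Mem x (V.stage n) := by
  induction x using Quot.ind with
  | mk a => exact ⟨a.1, a.1, a.2, Set.univ, trivial, rfl, rfl⟩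

namespace NonstandardUniverse

variable (U : NonstandardUniverse.{u})

theorem emb_mem {x y : V} (h : V.Mem x y) : memOf (U.emb x) (U.emb y) := by
  have := (U.emb.map_rel memSymb ![x, y]).2 h
  rwa [show U.emb ∘ ![x, y] = ![U.emb x, U.emb y] by ext i; fin_cases i <;> rfl] at this

/-- The nonstandard universe `*V`: the truncation of the elementary extension at rank `ω`, that is,
the objects which belong to `*(V_n)` for some standard `n`. -/
def Obj : Type u := {w : U.W // ∃ n : ℕ, memOf w (U.emb (V.stage n))}

variable {U}

/-- The membership relation of `*V`. -/
def Mem (x y : U.Obj) : Prop := memOf x.1 y.1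

variable (U) in
/-- The nonstandard version `*x` of a standard object `x`. -/
def star (x : V) : U.Obj :=
  ⟨U.emb x, (V.exists_mem_stage x).imp fun _ h => U.emb_mem h⟩

/-- The set of the members in `*V` of an object of `*V`. -/
def ext (w : U.Obj) : Set U.Obj := {x | Mem x w}

/-- Internal sets: the sets of members of the objects of `*V`. -/
def IsInternal (A : Set U.Obj) : Prop := ∃ w : U.Obj, A = ext w

end NonstandardUniverse

/-- The finite intersection property. -/
def HasFIP {α : Type*} (D : Set (Set α)) : Prop :=
  ∀ F : Set (Set α), F ⊆ D → F.Finite → (⋂₀ F).Nonempty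

namespace NonstandardUniverse

/-- `*V` is `lam`-saturated: every family of fewer than `lam` internal sets which has the
finite intersection property has nonempty intersection. -/
def IsSaturated (U : NonstandardUniverse.{u}) (lam : Cardinal.{u}) : Prop :=
  ∀ D : Set (Set U.Obj), (∀ A ∈ D, IsInternal A) → #D < lam → HasFIP D → (⋂₀ D).Nonempty

variable (U : NonstandardUniverse.{u})

/-- The set `*ℕ` of hypernatural numbers. -/
def hypernat : Set U.Obj := ext (U.star V.natSet)

/-- The hyperfinite integers: the elements of `*ℕ ∖ ℕ`. -/
def IsHyperfinite (H : U.Obj) : Prop := H ∈ U.hypernat ∧ ∀ n : ℕ, H ≠ U.star (V.nat n)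

variable {U}

/-- In `*V`, `z` is the unordered pair `{x, y}`. -/
def IsUPair (z x y : U.Obj) : Prop := ∀ t, Mem t z ↔ t = x ∨ t = y

/-- In `*V`, `p` is the Kuratowski pair `{{x}, {x, y}}`. -/
def IsPair (p x y : U.Obj) : Prop := ∀ z, Mem z p ↔ IsUPair z x x ∨ IsUPair z x y

/-- The order `*≤` of `*ℕ`. -/
def Le (a b : U.Obj) : Prop := ∃ p, IsPair p a b ∧ Mem p (U.star V.leGraph)

/-- The multiplication of `*ℕ`: `IsMul a b c` says that `a *· b = c`. -/
def IsMul (a b c : U.Obj) : Prop :=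
  ∃ q p, IsPair q a b ∧ IsPair p q c ∧ Mem p (U.star V.mulGraph)

/-- `a` is the internal cardinality `*|w|` of the hyperfinite subset `w` of `*ℕ`. -/
def IsCard (w a : U.Obj) : Prop := ∃ p, IsPair p w a ∧ Mem p (U.star V.cardGraph)

/-- The standard part of the hyperrational `a / H` (for `a, H ∈ *ℕ`, `H ≠ 0`): the supremum of the
standard rationals `p / q` with `p / q ≤ a / H`, that is, with `p *· H *≤ q *· a`. -/
noncomputable def stDiv (a H : U.Obj) : ℝ≥0∞ :=
  sSup {r | ∃ p q : ℕ, 0 < q ∧ r = (p : ℝ≥0∞) / (q : ℝ≥0∞) ∧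
    ∃ b c, IsMul (U.star (V.nat p)) H b ∧ IsMul (U.star (V.nat q)) a c ∧ Le b c}

/-! ## Hyperfinite Loeb spaces -/

/-- The hyperfinite set `Ω = {1, 2, …, H}`. -/
def Omega (H : U.Obj) : Set U.Obj :=
  {x | x ∈ U.hypernat ∧ Le (U.star (V.nat 1)) x ∧ Le x H}

/-- The function `st ∘ P` on the internal algebra `*𝒫(Ω)`, where `P(A) = *|A| / H`, extended by
`∞` to the subsets of `Ω` which are not internal. -/
noncomputable def stP (H : U.Obj) (A : Set (Omega H)) : ℝ≥0∞ :=
  ⨅ (w : U.Obj) (_ : ext w = Subtype.val '' A) (a : U.Obj) (_ : IsCard w a), stDiv a H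

/-- The Loeb outer measure on `Ω`: the outer measure given by coverings of a set by countably many
internal sets. -/
noncomputable def loebOuter (H : U.Obj) : OuterMeasure (Omega H) :=
  OuterMeasure.boundedBy (stP H)

/-- The Loeb `σ`-algebra `Σ`: the `σ`-algebra of the Carathéodory extension of `st ∘ P`, which is
the completion of the `σ`-algebra generated by the internal subsets of `Ω`. -/
noncomputable instance loebSpace (H : U.Obj) : MeasurableSpace (Omega H) :=
  (loebOuter H).caratheodory

/-- The Loeb measure `L_P` of the hyperfinite Loeb space on `Ω = {1, 2, …, H}`. -/
noncomputable def loebMeasure (H : U.Obj) : Measure (Omega H) :=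
  (loebOuter H).toMeasure le_rfl

end NonstandardUniverse

/-! ## Compact measure spaces -/

/-- A family `C` of sets is compact if every subfamily with the finite intersection property
has nonempty intersection. -/
def IsCompactFamily {Ω : Type*} (C : Set (Set Ω)) : Prop :=
  ∀ D ⊆ C, HasFIP D → (⋂₀ D).Nonempty

/-- A family `C` of sets is inner-regular if the measure of every measurable set `A` is the supremum
of the measures of the members of `C` contained in `A`. -/
def IsInnerRegular {Ω : Type*} [MeasurableSpace Ω] (P : Measure Ω) (C : Set (Set Ω)) : Prop :=
  ∀ A, MeasurableSet A → P A = sSup {r | ∃ K ∈ C, K ⊆ A ∧ r = P K}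

/-- A measure space is compact if it has an inner-regular compact family of measurable sets. -/
def IsCompactMeasure {Ω : Type*} [MeasurableSpace Ω] (P : Measure Ω) : Prop :=
  ∃ C : Set (Set Ω), (∀ K ∈ C, MeasurableSet K) ∧ IsCompactFamily C ∧ IsInnerRegular P C

end LoebCompact

/-! The compact family consists of sets `K c`, each the complement in Ω of a countable union of
internal sets, arranged so that any subfamily with the finite intersection property can be indexed
by at most κ of the `c`. Each `K c` is a countable intersection of internal sets, so κ⁺-saturation
handles such subfamilies (`IsSaturated.sInter_nonempty`).

An index `c` is a sequence of internal sets together with a number `N`. Since internal subsets of Ω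
can be coded by hypernaturals and `2 ^ κ` absorbs countable powers, there are at most `2 ^ κ = κ⁺`
indices. From the complement of the union of the sequence, `K c` removes further internal sets `Y c
m` of total measure at most `1 / (N + 1)`. Measurable sets are approximated from outside by
countable unions of internal sets, so taking complements and letting `N` grow gives inner
regularity.

The sets `Y c m` are coincidences of digits. In each standard base `n + 2` a point of Ω has digits
at more than κ places (`le_mk_digitIndex`), and two given places carry the same digit with
probability at most `3 / (n + 2)` (`card_sameDigit_mul_le`). Selecting κ places in every base maps Ω
into the product `X` of the spaces `κ → Fin (n + 2)`, which has at most `2 ^ κ = κ⁺` points.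

The coincidences are chosen by a diagonal argument (`exists_coincidence_systems`). Enumerate indices
and points of `X` along κ⁺. The at most κ points preceding `c` form a countable union of sets of
size less than κ, because κ has cofinality ω. On each of these sets two of the κ coordinates agree,
because κ is a strong limit. Declare these agreements to be the coincidences of `c`. Then every
point of `X` avoids the coincidences of at most κ indices. Given more than κ indices, no point
avoids all their coincidences, and by compactness of `X` finitely many of these indices already
suffice; the corresponding finitely many `K c` have empty intersection. -/

namespace LoebCompact

/-! ### The standard universe as a direct limit: equality, membership, extensionality. -/

namespace Level

theorem lift_injective : ∀ n, Function.Injective (lift n)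
  | 0 => fun _ _ h => Sum.inl_injective h
  | n + 1 => Function.injective_id.sumMap (lift_injective n).image_injective

/-- The inclusion `V_n ⊆ V_m` for `n ≤ m`. -/
def up {n m : ℕ} (h : n ≤ m) : Level n → Level m := Nat.leRecOn h (fun {k} => lift k)

theorem up_self {n : ℕ} (x : Level n) : up le_rfl x = x := Nat.leRecOn_self x

theorem up_succ {n m : ℕ} (h : n ≤ m) (x : Level n) :
    up (h.trans m.le_succ) x = lift m (up h x) := Nat.leRecOn_succ h x

theorem up_trans {n m k : ℕ} (h : n ≤ m) (h' : m ≤ k) (x : Level n) :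
    up (h.trans h') x = up h' (up h x) := Nat.leRecOn_trans h h' x

theorem up_injective {n m : ℕ} (h : n ≤ m) : Function.Injective (up h) :=
  Nat.leRecOn_injective h _ lift_injective

theorem up_set {n m : ℕ} (h : n ≤ m) (s : Set (Level n)) :
    up (Nat.succ_le_succ h) (set s) = set (up h '' s) := by
  induction m, h using Nat.le_induction with
  | base => rw [up_self]; simp [up_self]
  | succ m h ih =>
    rw [up_succ (Nat.succ_le_succ h), ih, show (up (h.trans m.le_succ) : Level n → _) =
      lift m ∘ up h from funext (up_succ h), Set.image_comp]
    rfl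

theorem lift_atom (n k : ℕ) : lift n (atom n k) = atom (n + 1) k := by
  cases n <;> rfl

end Level

namespace V

open Level

theorem of_lift (n : ℕ) (x : Level n) : of (n + 1) (lift n x) = of n x :=
  (Quot.sound (r := fun a b : Σ n, Level n => b = ⟨a.1 + 1, lift a.1 a.2⟩)
    (a := ⟨n, x⟩) (b := ⟨n + 1, lift n x⟩) rfl).symm

theorem of_up {n m : ℕ} (h : n ≤ m) (x : Level n) : of m (up h x) = of n x := by
  induction m, h using Nat.le_induction with
  | base => rw [up_self]
  | succ m h ih => rw [up_succ h, of_lift, ih]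

/-- The generating relation climbs one stage at a time, so by induction on its equivalence closure
identified elements already agree at a common later stage. With injectivity of the lifts, every
stage embeds in `V`. -/
theorem of_eq_of_iff {n m : ℕ} {x : Level n} {y : Level m} :
    of n x = of m y ↔ ∃ (k : ℕ) (h : n ≤ k) (h' : m ≤ k), up h x = up h' y := by
  constructor
  · intro h
    have key : ∀ a b : Σ n, Level n,
        Relation.EqvGen (fun a b : Σ n, Level n => b = ⟨a.1 + 1, lift a.1 a.2⟩) a b →
        ∃ (k : ℕ) (h : a.1 ≤ k) (h' : b.1 ≤ k), up h a.2 = up h' b.2 := by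
      intro a b hab
      induction hab with
      | rel a b hab =>
        subst hab
        exact ⟨a.1 + 1, Nat.le_succ _, le_rfl, by rw [up_self, up_succ le_rfl, up_self]⟩
      | refl a => exact ⟨a.1, le_rfl, le_rfl, rfl⟩
      | symm a b _ ih =>
        obtain ⟨k, h, h', e⟩ := ih
        exact ⟨k, h', h, e.symm⟩
      | trans a b c _ _ ih₁ ih₂ =>
        obtain ⟨k, h, h', e⟩ := ih₁
        obtain ⟨l, g, g', f⟩ := ih₂
        refine ⟨max k l, h.trans (le_max_left _ _), g'.trans (le_max_right _ _), ?_⟩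
        rw [up_trans h (le_max_left _ _), e, up_trans g' (le_max_right _ _), ← f,
          ← up_trans, ← up_trans]
    exact key ⟨n, x⟩ ⟨m, y⟩ (Quot.eqvGen_exact h)
  · rintro ⟨k, h, h', e⟩
    rw [← of_up h, ← of_up h', e]

theorem of_injective (n : ℕ) : Function.Injective (of n) := by
  intro x y h
  obtain ⟨k, h, h', e⟩ := of_eq_of_iff.1 h
  exact up_injective h e

theorem mem_of_set {x : V} {n : ℕ} {s : Set (Level n)} :
    Mem x (of (n + 1) (set s)) ↔ ∃ a ∈ s, x = of n a := by
  constructor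
  · rintro ⟨m, a, s', ha, rfl, e⟩
    obtain ⟨k, h, h', e⟩ := of_eq_of_iff.1 e
    obtain ⟨l, rfl⟩ : ∃ l, k = l + 1 := ⟨k - 1, by omega⟩
    have hn : n ≤ l := Nat.le_of_succ_le_succ h
    have hm : m ≤ l := Nat.le_of_succ_le_succ h'
    rw [up_set hn, up_set hm] at e
    have e' : up hn '' s = up hm '' s' := Sum.inr_injective e
    obtain ⟨b, hb, hba⟩ := e'.ge ⟨a, ha, rfl⟩
    exact ⟨b, hb, of_eq_of_iff.2 ⟨l, hm, hn, hba.symm⟩⟩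
  · rintro ⟨a, ha, rfl⟩
    exact ⟨n, a, s, ha, rfl, rfl⟩

theorem of_mem_of_set {n : ℕ} {a : Level n} {s : Set (Level n)} :
    Mem (of n a) (of (n + 1) (set s)) ↔ a ∈ s := by
  rw [mem_of_set]
  constructor
  · rintro ⟨b, hb, e⟩
    rwa [of_injective n e]
  · exact fun h => ⟨a, h, rfl⟩

theorem mem_stage {x : V} {n : ℕ} : Mem x (stage n) ↔ ∃ a, x = of n a := by
  simp [stage, mem_of_set]

theorem of_atom (n k : ℕ) : of n (atom n k) = nat k := by
  induction n with
  | zero => rfl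
  | succ n ih => rw [← lift_atom, of_lift, ih]

theorem nat_injective : Function.Injective nat := of_injective 0

@[simp] theorem nat_inj {a b : ℕ} : nat a = nat b ↔ a = b := nat_injective.eq_iff

theorem mem_natSet {x : V} : Mem x natSet ↔ ∃ k, x = nat k := mem_stage

@[simp] theorem nat_mem_natSet (k : ℕ) : Mem (nat k) natSet := mem_natSet.2 ⟨k, rfl⟩

theorem not_mem_nat (x : V) (k : ℕ) : ¬ Mem x (nat k) := by
  rintro ⟨n, a, s, _, _, e⟩
  rw [← of_atom (n + 1)] at e
  cases of_injective _ e

theorem set_of_mem {x y : V} (h : Mem x y) : ∃ n s, y = of (n + 1) (set s) := by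
  obtain ⟨n, a, s, _, _, e⟩ := h
  exact ⟨n, s, e⟩

theorem of_set_up {n m : ℕ} (h : n ≤ m) (s : Set (Level n)) :
    of (m + 1) (set (up h '' s)) = of (n + 1) (set s) := by
  rw [← up_set h, of_up]

/-- A member `t` is required because the urelements and the empty set all have no members. -/
theorem eq_of_forall_mem_iff {x y t : V} (ht : Mem t x) (h : ∀ z, Mem z x ↔ Mem z y) :
    x = y := by
  obtain ⟨n, s, rfl⟩ := set_of_mem ht
  obtain ⟨m, s', rfl⟩ := set_of_mem ((h t).1 ht)
  rw [← of_set_up (le_max_left n m), ← of_set_up (le_max_right n m)] at h ⊢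
  congr 2
  ext a
  have := h (of _ a)
  rwa [of_mem_of_set, of_mem_of_set] at this

theorem stage_mono {x : V} {n m : ℕ} (h : n ≤ m) (hx : Mem x (stage n)) : Mem x (stage m) := by
  obtain ⟨a, rfl⟩ := mem_stage.1 hx
  exact mem_stage.2 ⟨up h a, (of_up h a).symm⟩

theorem mem_stage_trans {x y : V} {n : ℕ} (hx : Mem x (stage n)) (hy : Mem y x) :
    Mem y (stage n) := by
  obtain ⟨a, rfl⟩ := mem_stage.1 hx
  cases n with
  | zero => exact absurd hy (not_mem_nat _ a)
  | succ n =>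
    cases a with
    | inl k => exact absurd (of_atom (n + 1) k ▸ hy) (not_mem_nat _ k)
    | inr s =>
      obtain ⟨b, _, rfl⟩ := mem_of_set.1 hy
      exact mem_stage.2 ⟨lift n b, (of_lift n b).symm⟩

end V

/-! ### Bounded descriptions of pairs and triples, and the standard graphs. -/

/-- In the universe `(M, E)`, `z` is the unordered pair `{x, y}` (with bounded quantifiers). -/
def UPair {M : Type*} (E : M → M → Prop) (z x y : M) : Prop :=
  E x z ∧ E y z ∧ ∀ t, E t z → t = x ∨ t = y

/-- In the universe `(M, E)`, `p` is the Kuratowski pair `{{x}, {x, y}}`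
(with bounded quantifiers). -/
def KPair {M : Type*} (E : M → M → Prop) (p x y : M) : Prop :=
  (∃ z, E z p ∧ UPair E z x x) ∧ (∃ z, E z p ∧ UPair E z x y) ∧
    ∀ z, E z p → UPair E z x x ∨ UPair E z x y

/-- In the universe `(M, E)`, the pair `(x, y)` belongs to `g`. -/
def PairMem {M : Type*} (E : M → M → Prop) (g x y : M) : Prop :=
  ∃ p, E p g ∧ KPair E p x y

/-- In the universe `(M, E)`, the triple `((x, y), z)` belongs to `g`. -/
def TripleMem {M : Type*} (E : M → M → Prop) (g x y z : M) : Prop :=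
  ∃ p, E p g ∧ ∃ r, E r p ∧ ∃ q, E q r ∧ KPair E q x y ∧ KPair E p q z

/-- Only the members of members of `p` are compared, so no extensionality of `E` is needed. -/
theorem KPair.inj {M : Type*} {E : M → M → Prop} {p x y x' y' : M} (h : KPair E p x y)
    (h' : KPair E p x' y') : x = x' ∧ y = y' := by
  unfold KPair UPair at h h'
  grind

namespace V

open Level

/-- The unordered pair `{x, y}` in `V_{n+1}`. -/
theorem uPair_of {n : ℕ} (x y : Level n) :
    UPair Mem (of (n + 1) (set {x, y})) (of n x) (of n y) := by
  refine ⟨of_mem_of_set.2 (by simp), of_mem_of_set.2 (by simp), fun t ht => ?_⟩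
  obtain ⟨a, ha, rfl⟩ := mem_of_set.1 ht
  rcases ha with rfl | rfl <;> simp

theorem kPair_of {n : ℕ} (x y : Level n) :
    KPair Mem (of (n + 2) (Level.pair x y)) (of n x) (of n y) := by
  refine ⟨⟨of (n + 1) (set {x}), of_mem_of_set.2 (by simp), by simpa using uPair_of x x⟩,
    ⟨of (n + 1) (set {x, y}), of_mem_of_set.2 (by simp), uPair_of x y⟩, fun t ht => ?_⟩
  obtain ⟨a, ha, rfl⟩ := mem_of_set.1 ht
  rcases ha with rfl | rfl
  · exact .inl (by simpa using uPair_of x x)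
  · exact .inr (uPair_of x y)

theorem exists_uPair {x y : V} {n : ℕ} (hx : Mem x (stage n)) (hy : Mem y (stage n)) :
    ∃ z, Mem z (stage (n + 1)) ∧ UPair Mem z x y := by
  obtain ⟨a, rfl⟩ := mem_stage.1 hx
  obtain ⟨b, rfl⟩ := mem_stage.1 hy
  exact ⟨_, mem_stage.2 ⟨_, rfl⟩, uPair_of a b⟩

/-- The finite set `A` of natural numbers as an element of `V`. -/
def fin (A : Finset ℕ) : V := of 1 (Level.set {x | ∃ a ∈ A, x = Level.atom 0 a})

theorem mem_fin {A : Finset ℕ} {x : V} : Mem x (fin A) ↔ ∃ a ∈ A, x = nat a := by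
  rw [fin, mem_of_set]
  constructor
  · rintro ⟨b, ⟨a, ha, e⟩, rfl⟩
    exact ⟨a, ha, congrArg (of 0) e⟩
  · rintro ⟨a, ha, rfl⟩
    exact ⟨_, ⟨a, ha, rfl⟩, rfl⟩

@[simp] theorem nat_mem_fin {A : Finset ℕ} {a : ℕ} : Mem (nat a) (fin A) ↔ a ∈ A := by
  simp [mem_fin]

theorem fin_mem_stage (A : Finset ℕ) : Mem (fin A) (stage 1) := mem_stage.2 ⟨_, rfl⟩

/-- The graph `{((a, b), g a b)}` of a binary operation on `ℕ`. -/
def opGraph (g : ℕ → ℕ → ℕ) : V :=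
  of 5 (Level.set {p | ∃ a b : ℕ,
    p = Level.pair (Level.pair (Level.atom 0 a) (Level.atom 0 b)) (Level.atom 2 (g a b))})

/-- The graph `{(A, f A)}` of a function on the finite subsets of `ℕ`. -/
def finGraph (f : Finset ℕ → ℕ) : V :=
  of 4 (Level.set {p | ∃ A : Finset ℕ,
    p = Level.pair (Level.set {x | ∃ a ∈ A, x = Level.atom 0 a}) (Level.atom 1 (f A))})

theorem pairMem_leGraph {x y : V} :
    PairMem Mem leGraph x y ↔ ∃ a b : ℕ, a ≤ b ∧ x = nat a ∧ y = nat b := by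
  constructor
  · rintro ⟨p, hp, hk⟩
    obtain ⟨_, ⟨a, b, hab, rfl⟩, rfl⟩ := mem_of_set.1 hp
    exact ⟨a, b, hab, hk.inj (kPair_of (n := 0) _ _)⟩
  · rintro ⟨a, b, hab, rfl, rfl⟩
    exact ⟨_, mem_of_set.2 ⟨_, ⟨a, b, hab, rfl⟩, rfl⟩, kPair_of (n := 0) _ _⟩

theorem pairMem_finGraph {f : Finset ℕ → ℕ} {x y : V} :
    PairMem Mem (finGraph f) x y ↔ ∃ A : Finset ℕ, x = fin A ∧ y = nat (f A) := by
  constructor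
  · rintro ⟨p, hp, hk⟩
    obtain ⟨_, ⟨A, rfl⟩, rfl⟩ := mem_of_set.1 hp
    have := hk.inj (kPair_of (n := 1) _ _)
    rw [of_atom] at this
    exact ⟨A, this⟩
  · rintro ⟨A, rfl, rfl⟩
    refine ⟨_, mem_of_set.2 ⟨_, ⟨A, rfl⟩, rfl⟩, ?_⟩
    rw [← of_atom 1]
    exact kPair_of (n := 1) _ _

theorem tripleMem_opGraph {g : ℕ → ℕ → ℕ} {x y z : V} :
    TripleMem Mem (opGraph g) x y z ↔
      ∃ a b : ℕ, x = nat a ∧ y = nat b ∧ z = nat (g a b) := by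
  constructor
  · rintro ⟨p, hp, r, _, q, _, hq, hk⟩
    obtain ⟨_, ⟨a, b, rfl⟩, rfl⟩ := mem_of_set.1 hp
    obtain ⟨rfl, rfl⟩ := hk.inj (kPair_of (n := 2) _ _)
    obtain ⟨rfl, rfl⟩ := hq.inj (kPair_of (n := 0) _ _)
    exact ⟨a, b, rfl, rfl, of_atom _ _⟩
  · rintro ⟨a, b, rfl, rfl, rfl⟩
    refine ⟨_, mem_of_set.2 ⟨_, ⟨a, b, rfl⟩, rfl⟩,
      of 3 (Level.set {Level.pair (Level.atom 0 a) (Level.atom 0 b)}),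
      of_mem_of_set.2 (by simp), of 2 (Level.pair (Level.atom 0 a) (Level.atom 0 b)),
      of_mem_of_set.2 (by simp), kPair_of (n := 0) _ _, ?_⟩
    rw [← of_atom 2]
    exact kPair_of (n := 2) _ _

end V

/-! ### Transfer for bounded formulas, from the standard universe to the truncation. -/

open FirstOrder FirstOrder.Language

theorem memOf_V {x y : V} : memOf x y ↔ V.Mem x y := Iff.rfl

/-- The atomic formula `a ∈ b`. -/
def memFormula {β : Type*} (a b : β) : memLang.Formula β :=
  memSymb.formula₂ (Term.var a) (Term.var b)

theorem realize_memFormula {β M : Type*} [memLang.Structure M] {a b : β} {v : β → M} :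
    (memFormula a b).Realize v ↔ memOf (v a) (v b) := by
  rw [memFormula, Formula.realize_rel₂]
  rfl

namespace NonstandardUniverse

variable {U : NonstandardUniverse.{u}}

/-- Quantifying the variables in `α` universally leaves a formula with only standard parameters, to
which elementarity applies. -/
theorem realize_emb_of_forall {α : Type} [Finite α] {φ : memLang.Formula (V ⊕ α)}
    (h : ∀ v : α → V, φ.Realize (Sum.elim id v)) (w : α → U.W) :
    φ.Realize (Sum.elim U.emb w) := by
  have h₁ : (φ.iAlls α).Realize (id : V → V) := Formula.realize_iAlls.2 h
  exact Formula.realize_iAlls.1 ((U.emb.map_formula _ _).2 h₁) w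

theorem memOf_stage_trans {n : ℕ} {x y : U.W} (hx : memOf x (U.emb (V.stage n)))
    (hy : memOf y x) : memOf y (U.emb (V.stage n)) := by
  have := realize_emb_of_forall (U := U) (φ := (memFormula (.inr 0) (.inl (V.stage n))).imp
    ((memFormula (.inr 1) (.inr 0)).imp (memFormula (.inr (1 : Fin 2)) (.inl (V.stage n)))))
    (fun v => by
      simp only [Formula.realize_imp, realize_memFormula]
      exact V.mem_stage_trans) ![x, y]
  simp only [Formula.realize_imp, realize_memFormula] at this
  exact this hx hy

theorem exists_mem_stage_of_memOf {x : U.Obj} {y : U.W} (hy : memOf y x.1) :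
    ∃ n, memOf y (U.emb (V.stage n)) :=
  x.2.imp fun _ hx => memOf_stage_trans hx hy

/-- `P` and `Q` are the interpretations in the standard and the nonstandard universe of one
formula with parameters in the standard universe. -/
def Transfers {α : Type} (P : (α → V) → Prop) (Q : (α → U.Obj) → Prop) : Prop :=
  ∃ φ : memLang.Formula (V ⊕ α), (∀ v, φ.Realize (Sum.elim id v) ↔ P v) ∧
    ∀ w : α → U.Obj, φ.Realize (Sum.elim U.emb fun a => (w a).1) ↔ Q w

/-- `s` and `t` are the interpretations in the standard and the nonstandard universe of one
variable or parameter. -/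
def TermTransfers {α : Type} (s : (α → V) → V) (t : (α → U.Obj) → U.Obj) : Prop :=
  ∃ k : V ⊕ α, (∀ v, s v = Sum.elim id v k) ∧ ∀ w, t w = Sum.elim U.star w k

theorem termTransfers_var {α : Type} (a : α) :
    TermTransfers (U := U) (fun v => v a) (fun w => w a) := ⟨.inr a, fun _ => rfl, fun _ => rfl⟩

theorem termTransfers_const {α : Type} (c : V) :
    TermTransfers (U := U) (α := α) (fun _ => c) (fun _ => U.star c) :=
  ⟨.inl c, fun _ => rfl, fun _ => rfl⟩

theorem val_sumElim_star {α : Type} (w : α → U.Obj) (k : V ⊕ α) :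
    (Sum.elim U.star w k).1 = Sum.elim U.emb (fun a => (w a).1) k := by
  cases k <;> rfl

namespace Transfers

variable {α : Type} {P P' : (α → V) → Prop} {Q Q' : (α → U.Obj) → Prop}
  {s s' : (α → V) → V} {t t' : (α → U.Obj) → U.Obj}

/-- The transfer principle. -/
theorem transfer [Finite α] (h : Transfers P Q) (hP : ∀ v, P v) (w : α → U.Obj) : Q w := by
  obtain ⟨φ, h₁, h₂⟩ := h
  exact (h₂ w).1 (realize_emb_of_forall (fun v => (h₁ v).2 (hP v)) _)

theorem mem (h : TermTransfers s t) (h' : TermTransfers s' t') :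
    Transfers (fun v => V.Mem (s v) (s' v)) (fun w => Mem (t w) (t' w)) := by
  obtain ⟨a, h₁, h₂⟩ := h
  obtain ⟨b, h₃, h₄⟩ := h'
  refine ⟨memFormula a b, fun v => ?_, fun w => ?_⟩
  · simp only [realize_memFormula, memOf_V, h₁, h₃]
  · simp only [realize_memFormula, Mem, h₂, h₄, val_sumElim_star]

theorem eq (h : TermTransfers s t) (h' : TermTransfers s' t') :
    Transfers (fun v => s v = s' v) (fun w => t w = t' w) := by
  obtain ⟨a, h₁, h₂⟩ := h
  obtain ⟨b, h₃, h₄⟩ := h'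
  refine ⟨Term.equal (Term.var a) (Term.var b), fun v => ?_, fun w => ?_⟩
  · simp [h₁, h₃]
  · simp only [Formula.realize_equal, Term.realize_var, h₂, h₄, ← val_sumElim_star]
    exact Subtype.ext_iff.symm

theorem not (h : Transfers P Q) : Transfers (fun v => ¬ P v) (fun w => ¬ Q w) := by
  obtain ⟨φ, h₁, h₂⟩ := h
  exact ⟨∼φ, fun v => by simp [h₁], fun w => by simp [h₂]⟩

theorem imp (h : Transfers P Q) (h' : Transfers P' Q') :
    Transfers (fun v => P v → P' v) (fun w => Q w → Q' w) := by
  obtain ⟨φ, h₁, h₂⟩ := h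
  obtain ⟨ψ, h₃, h₄⟩ := h'
  exact ⟨φ.imp ψ, fun v => by simp [h₁, h₃], fun w => by simp [h₂, h₄]⟩

theorem congr (h : Transfers P Q) (hP : ∀ v, P v ↔ P' v) (hQ : ∀ w, Q w ↔ Q' w) :
    Transfers P' Q' := by
  obtain rfl : P = P' := funext fun v => propext (hP v)
  obtain rfl : Q = Q' := funext fun v => propext (hQ v)
  exact h

theorem and (h : Transfers P Q) (h' : Transfers P' Q') :
    Transfers (fun v => P v ∧ P' v) (fun w => Q w ∧ Q' w) :=
  (h.imp h'.not).not.congr (fun v => by tauto) (fun w => by tauto)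

theorem or (h : Transfers P Q) (h' : Transfers P' Q') :
    Transfers (fun v => P v ∨ P' v) (fun w => Q w ∨ Q' w) :=
  (h.not.imp h').congr (fun v => by tauto) (fun w => by tauto)

/-- Truncation is harmless for bounded quantifiers: a witness found in `W` is a member of an object
of the truncation, and stages are transitive, so it lies in the truncation too. -/
theorem ex {R : (α → V) → V → Prop} {S : (α → U.Obj) → U.Obj → Prop} (h : TermTransfers s t)
    (hR : Transfers (fun v : Option α → V => R (fun a => v (some a)) (v none))
      (fun w : Option α → U.Obj => S (fun a => w (some a)) (w none))) :
    Transfers (fun v => ∃ x, V.Mem x (s v) ∧ R v x) (fun w => ∃ x, Mem x (t w) ∧ S w x) := by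
  obtain ⟨k, h₁, h₂⟩ := h
  obtain ⟨φ, h₃, h₄⟩ := hR
  -- The variable `none` is the one being quantified; it goes to the slot bound by `iExs`.
  let r : V ⊕ Option α → (V ⊕ α) ⊕ Unit :=
    Sum.elim (fun c => .inl (.inl c)) (Option.elim · (.inr ()) fun a => .inl (.inr a))
  refine ⟨Formula.iExs Unit (memFormula (.inr ()) (.inl k) ⊓ φ.relabel r), fun v => ?_,
    fun w => ?_⟩
  · rw [Formula.realize_iExs]
    simp only [Formula.realize_inf, realize_memFormula, Formula.realize_relabel, Sum.elim_inr,
      Sum.elim_inl, memOf_V]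
    have key : ∀ i : Unit → V, φ.Realize (Sum.elim (Sum.elim id v) i ∘ r) ↔ R v (i ()) := by
      intro i
      rw [show Sum.elim (Sum.elim id v) i ∘ r = Sum.elim id (Option.elim · (i ()) v) by
        ext (c | _ | a) <;> rfl]
      exact h₃ _
    simp only [key, ← h₁]
    exact ⟨fun ⟨i, hi⟩ => ⟨i (), hi⟩, fun ⟨x, hx⟩ => ⟨fun _ => x, hx⟩⟩
  · rw [Formula.realize_iExs]
    simp only [Formula.realize_inf, realize_memFormula, Formula.realize_relabel, Sum.elim_inr,
      Sum.elim_inl]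
    have key : ∀ x : U.Obj, φ.Realize (Sum.elim (Sum.elim U.emb fun a => (w a).1)
        (fun _ => x.1) ∘ r) ↔ S w x := by
      intro x
      rw [show Sum.elim (Sum.elim U.emb fun a => (w a).1) (fun _ => x.1) ∘ r =
          Sum.elim U.emb (fun o => (Option.elim o x w).1) by
        ext (c | _ | a) <;> rfl]
      exact h₄ _
    simp only [← val_sumElim_star, ← h₂]
    constructor
    · rintro ⟨i, hi, hi'⟩
      exact ⟨⟨i (), exists_mem_stage_of_memOf hi⟩, hi, (key ⟨i (), _⟩).1 hi'⟩
    · rintro ⟨x, hx, hx'⟩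
      exact ⟨fun _ => x.1, hx, (key x).2 hx'⟩

theorem all {R : (α → V) → V → Prop} {S : (α → U.Obj) → U.Obj → Prop} (h : TermTransfers s t)
    (hR : Transfers (fun v : Option α → V => R (fun a => v (some a)) (v none))
      (fun w : Option α → U.Obj => S (fun a => w (some a)) (w none))) :
    Transfers (fun v => ∀ x, V.Mem x (s v) → R v x) (fun w => ∀ x, Mem x (t w) → S w x) :=
  (ex (R := fun v x => ¬ R v x) (S := fun w x => ¬ S w x) h hR.not).not.congr
    (fun v => by push Not; rfl) (fun w => by push Not; rfl)

end Transfers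

theorem TermTransfers.weaken {α : Type} {s : (α → V) → V} {t : (α → U.Obj) → U.Obj}
    (h : TermTransfers s t) : TermTransfers (fun v : Option α → V => s fun a => v (some a))
      (fun w : Option α → U.Obj => t fun a => w (some a)) := by
  obtain ⟨c | a, h₁, h₂⟩ := h
  · exact ⟨.inl c, fun v => h₁ _, fun w => h₂ _⟩
  · exact ⟨.inr (some a), fun v => h₁ _, fun w => h₂ _⟩

namespace Transfers

variable {α : Type} {s₁ s₂ s₃ s₄ : (α → V) → V} {t₁ t₂ t₃ t₄ : (α → U.Obj) → U.Obj}

theorem uPair (h₁ : TermTransfers s₁ t₁) (h₂ : TermTransfers s₂ t₂) (h₃ : TermTransfers s₃ t₃) :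
    Transfers (fun v => UPair V.Mem (s₁ v) (s₂ v) (s₃ v))
      (fun w => UPair Mem (t₁ w) (t₂ w) (t₃ w)) :=
  (mem h₂ h₁).and ((mem h₃ h₁).and (all h₁ ((eq (termTransfers_var none) h₂.weaken).or
    (eq (termTransfers_var none) h₃.weaken))))

theorem kPair (h₁ : TermTransfers s₁ t₁) (h₂ : TermTransfers s₂ t₂) (h₃ : TermTransfers s₃ t₃) :
    Transfers (fun v => KPair V.Mem (s₁ v) (s₂ v) (s₃ v))
      (fun w => KPair Mem (t₁ w) (t₂ w) (t₃ w)) :=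
  (ex h₁ (uPair (termTransfers_var none) h₂.weaken h₂.weaken)).and
    ((ex h₁ (uPair (termTransfers_var none) h₂.weaken h₃.weaken)).and
      (all h₁ ((uPair (termTransfers_var none) h₂.weaken h₂.weaken).or
        (uPair (termTransfers_var none) h₂.weaken h₃.weaken))))

theorem pairMem (h₁ : TermTransfers s₁ t₁) (h₂ : TermTransfers s₂ t₂) (h₃ : TermTransfers s₃ t₃) :
    Transfers (fun v => PairMem V.Mem (s₁ v) (s₂ v) (s₃ v))
      (fun w => PairMem Mem (t₁ w) (t₂ w) (t₃ w)) :=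
  ex h₁ (kPair (termTransfers_var none) h₂.weaken h₃.weaken)

theorem tripleMem (h₁ : TermTransfers s₁ t₁) (h₂ : TermTransfers s₂ t₂)
    (h₃ : TermTransfers s₃ t₃) (h₄ : TermTransfers s₄ t₄) :
    Transfers (fun v => TripleMem V.Mem (s₁ v) (s₂ v) (s₃ v) (s₄ v))
      (fun w => TripleMem Mem (t₁ w) (t₂ w) (t₃ w) (t₄ w)) := by
  refine ex (R := fun v p => ∃ r, V.Mem r p ∧ ∃ q, V.Mem q r ∧ KPair V.Mem q (s₂ v) (s₃ v) ∧
    KPair V.Mem p q (s₄ v)) (S := fun w p => ∃ r, Mem r p ∧ ∃ q, Mem q r ∧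
      KPair Mem q (t₂ w) (t₃ w) ∧ KPair Mem p q (t₄ w)) h₁
    (ex (termTransfers_var none) (ex (termTransfers_var none) (and
      (kPair (termTransfers_var none) h₂.weaken.weaken.weaken h₃.weaken.weaken.weaken)
      (kPair (termTransfers_var (some (some none))) (termTransfers_var none)
        h₄.weaken.weaken.weaken))))

end Transfers

/-! ## Pairs in the nonstandard universe -/

theorem isUPair_iff {z x y : U.Obj} : IsUPair z x y ↔ UPair Mem z x y := by
  unfold IsUPair UPair
  grind

theorem exists_uPair (x y : U.Obj) : ∃ z, UPair Mem z x y := by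
  obtain ⟨n, hx⟩ := x.2
  obtain ⟨m, hy⟩ := y.2
  have := Transfers.transfer (P := fun v : Fin 2 → V => V.Mem (v 0) (V.stage n) →
      V.Mem (v 1) (V.stage m) → ∃ z, V.Mem z (V.stage (n + m + 1)) ∧ UPair V.Mem z (v 0) (v 1))
    (Q := fun w : Fin 2 → U.Obj => Mem (w 0) (U.star (V.stage n)) →
      Mem (w 1) (U.star (V.stage m)) → ∃ z, Mem z (U.star (V.stage (n + m + 1))) ∧
        UPair Mem z (w 0) (w 1))
    (by
      repeat' first
        | exact termTransfers_var _ | exact termTransfers_const _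
        | apply Transfers.uPair
        | apply Transfers.imp | apply Transfers.mem | apply Transfers.ex)
    (fun v hx hy => V.exists_uPair (V.stage_mono (Nat.le_add_right n m) hx)
      (V.stage_mono (Nat.le_add_left m n) hy)) ![x, y] hx hy
  exact this.imp fun _ h => h.2

theorem uPair_unique {z z' x y : U.Obj} (h : UPair Mem z x y) (h' : UPair Mem z' x y) :
    z = z' := by
  refine Transfers.transfer (P := fun v : Fin 4 → V => UPair V.Mem (v 0) (v 2) (v 3) →
      UPair V.Mem (v 1) (v 2) (v 3) → v 0 = v 1)
    (Q := fun w : Fin 4 → U.Obj => UPair Mem (w 0) (w 2) (w 3) →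
      UPair Mem (w 1) (w 2) (w 3) → w 0 = w 1)
    (by
      repeat' first
        | exact termTransfers_var _ | exact termTransfers_const _
        | apply Transfers.imp | apply Transfers.eq | apply Transfers.uPair)
    (fun v h h' => V.eq_of_forall_mem_iff h.1 fun t => ?_) ![z, z', x, y] h h'
  unfold UPair at h h'
  grind

/-- `IsPair` quantifies over the whole truncation; the bounded form is equivalent because unordered
pairs exist and are unique there, both by transfer. -/
theorem isPair_iff {p x y : U.Obj} : IsPair p x y ↔ KPair Mem p x y := by
  simp only [IsPair, isUPair_iff]
  constructor
  · intro h
    obtain ⟨z, hz⟩ := exists_uPair x x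
    obtain ⟨z', hz'⟩ := exists_uPair x y
    exact ⟨⟨z, (h z).2 (.inl hz), hz⟩, ⟨z', (h z').2 (.inr hz'), hz'⟩, fun t ht => (h t).1 ht⟩
  · rintro ⟨⟨z, hz, hz₁⟩, ⟨z', hz', hz₂⟩, h⟩ t
    refine ⟨h t, ?_⟩
    rintro (ht | ht)
    · rwa [uPair_unique ht hz₁]
    · rwa [uPair_unique ht hz₂]

theorem le_iff {a b : U.Obj} : Le a b ↔ PairMem Mem (U.star V.leGraph) a b := by
  simp only [Le, isPair_iff, PairMem, and_comm]

theorem isCard_iff {w a : U.Obj} :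
    IsCard w a ↔ PairMem Mem (U.star (V.finGraph Finset.card)) w a := by
  simp only [IsCard, isPair_iff, PairMem, and_comm]
  rfl

theorem isMul_iff {a b c : U.Obj} :
    IsMul a b c ↔ TripleMem Mem (U.star (V.opGraph (· * ·))) a b c := by
  simp only [IsMul, isPair_iff, TripleMem]
  constructor
  · rintro ⟨q, p, hq, hp, hm⟩
    -- The singleton of `q`, a member of `p`, serves as the bound for `q` in `TripleMem`.
    obtain ⟨r, hr, hr'⟩ := hp.1
    exact ⟨p, hm, r, hr, q, hr'.1, hq, hp⟩
  · rintro ⟨p, hm, r, hr, q, hr', hq, hp⟩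
    exact ⟨q, p, hq, hp, hm⟩

end NonstandardUniverse

/-! ### The arithmetic to be transferred: ratios, digits and their coincidences. -/

/-- In the universe `(M, E)`, the inequality `p * x ≤ q * y` of natural numbers. -/
def MulLe {M : Type*} (E : M → M → Prop) (nat mul le p x q y : M) : Prop :=
  ∃ b, E b nat ∧ ∃ c, E c nat ∧ TripleMem E mul p x b ∧ TripleMem E mul q y c ∧ PairMem E le b c

/-- The indicator of `(n + 2) ^ (i + 1) ≤ h`. -/
def digitGuard (n i h : ℕ) : ℕ := if (n + 2) ^ (i + 1) ≤ h then 1 else 0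

/-- The `i`-th digit of `x` in base `n + 2`. -/
def digit (n i x : ℕ) : ℕ := x / (n + 2) ^ i % (n + 2)

/-- The numbers `x ∈ {1, …, h}` whose `i`-th and `j`-th digits in base `n + 2` agree. -/
def sameDigit (n h i j : ℕ) : Finset ℕ := {x ∈ Finset.Icc 1 h | digit n i x = digit n j x}

/-- Digit `i` is determined by the part of the number below place `j` if `i < j`, and by the part
above it if `i > j`. -/
theorem digit_eq_of_div_eq_of_mod_eq {n i j x y : ℕ} (hij : i ≠ j)
    (hd : x / (n + 2) ^ (j + 1) = y / (n + 2) ^ (j + 1))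
    (hm : x % (n + 2) ^ j = y % (n + 2) ^ j) : digit n i x = digit n i y := by
  rcases lt_or_gt_of_ne hij with h | h
  · obtain ⟨k, rfl⟩ := Nat.exists_eq_add_of_lt h
    have key : ∀ z, digit n i z = digit n i (z % (n + 2) ^ (i + k + 1)) := by
      intro z
      rw [digit, digit, add_assoc, pow_add, Nat.mod_mul_right_div_self, pow_succ,
        Nat.mod_mul_left_mod]
    rw [key x, key y, hm]
  · obtain ⟨k, rfl⟩ := Nat.exists_eq_add_of_lt h
    rw [digit, digit, show j + k + 1 = j + 1 + k by omega, pow_add, ← Nat.div_div_eq_div_mul,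
      ← Nat.div_div_eq_div_mul, hd]

/-- Overwriting digit `j` by any of the `n + 2` values loses no information on numbers whose digits
`i` and `j` agree, as the old digit can be read off at place `i`. The map `f` does this overwriting.
-/
theorem card_sameDigit_mul_le {n h i j : ℕ} (hij : i ≠ j) (hj : (n + 2) ^ (j + 1) ≤ h) :
    (sameDigit n h i j).card * (n + 2) ≤ 3 * h := by
  have hpos : 0 < (n + 2) ^ j := by positivity
  let f : ℕ × ℕ → ℕ := fun p =>
    p.1 / (n + 2) ^ (j + 1) * (n + 2) ^ (j + 1) + (p.2 * (n + 2) ^ j + p.1 % (n + 2) ^ j)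
  have hlt : ∀ p : ℕ × ℕ, p.2 < n + 2 →
      p.2 * (n + 2) ^ j + p.1 % (n + 2) ^ j < (n + 2) ^ (j + 1) := by
    intro p hp
    have h₁ := Nat.mod_lt p.1 hpos
    have h₂ : (p.2 + 1) * (n + 2) ^ j ≤ (n + 2) * (n + 2) ^ j := Nat.mul_le_mul_right _ hp
    rw [pow_succ']
    linarith
  have hdiv : ∀ p : ℕ × ℕ, p.2 < n + 2 → f p / (n + 2) ^ (j + 1) = p.1 / (n + 2) ^ (j + 1) := by
    intro p hp
    simp only [f]
    rw [mul_comm, Nat.mul_add_div (by positivity), Nat.div_eq_of_lt (hlt p hp), add_zero]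
  have hmod : ∀ p : ℕ × ℕ, f p % (n + 2) ^ j = p.1 % (n + 2) ^ j := by
    intro p
    simp only [f]
    rw [pow_succ', ← mul_assoc, ← add_assoc, ← add_mul, Nat.mul_add_mod_self_right, Nat.mod_mod]
  have hsplit : ∀ x, x = x / (n + 2) ^ (j + 1) * (n + 2) ^ (j + 1) +
      (digit n j x * (n + 2) ^ j + x % (n + 2) ^ j) := by
    intro x
    have h₁ := Nat.div_add_mod x ((n + 2) ^ j)
    have h₂ := Nat.div_add_mod (x / (n + 2) ^ j) (n + 2)
    rw [Nat.div_div_eq_div_mul, ← pow_succ] at h₂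
    rw [digit]
    generalize x / (n + 2) ^ j % (n + 2) = d at *
    generalize x / (n + 2) ^ (j + 1) = e at *
    rw [← h₂] at h₁
    rw [pow_succ]
    linarith
  have hinj : Set.InjOn f (sameDigit n h i j ×ˢ Finset.range (n + 2) : Finset (ℕ × ℕ)) := by
    rintro ⟨x, t⟩ hx ⟨y, s⟩ hy hf
    simp only [Finset.coe_product, Set.mem_prod, Finset.mem_coe, Finset.mem_range, sameDigit,
      Finset.mem_filter] at hx hy
    have hd : x / (n + 2) ^ (j + 1) = y / (n + 2) ^ (j + 1) := by
      rw [← hdiv (x, t) hx.2, ← hdiv (y, s) hy.2, hf]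
    have hm : x % (n + 2) ^ j = y % (n + 2) ^ j := by
      rw [← hmod (x, t), ← hmod (y, s), hf]
    have hdig : digit n j x = digit n j y := by
      rw [← hx.1.2, ← hy.1.2, digit_eq_of_div_eq_of_mod_eq hij hd hm]
    have hxy : x = y := by rw [hsplit x, hsplit y, hd, hm, hdig]
    subst hxy
    have hts : t * (n + 2) ^ j = s * (n + 2) ^ j := by
      simp only [f] at hf
      omega
    rw [Nat.eq_of_mul_eq_mul_right hpos hts]
  -- The values of `f` are below `h + (n + 2) ^ (j + 1) ≤ 2 * h`, so `3 * h` is a generous bound.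
  have := Finset.card_le_card_of_injOn (t := Finset.range (3 * h)) f (fun p hp => by
    obtain ⟨hx, ht⟩ := Finset.mem_product.1 hp
    have h₁ := (Finset.mem_Icc.1 (Finset.mem_filter.1 hx).1).2
    have h₂ := hlt p (Finset.mem_range.1 ht)
    have h₃ := Nat.div_mul_le_self p.1 ((n + 2) ^ (j + 1))
    have h₄ : 0 < (n + 2) ^ (j + 1) := by positivity
    simp only [Finset.coe_range, Set.mem_Iio, f]
    omega) hinj
  rwa [Finset.card_product, Finset.card_range, Finset.card_range] at this

namespace V

theorem mulLe_iff {x y : V} {p q : ℕ} :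
    MulLe Mem natSet (opGraph (· * ·)) leGraph (nat p) x (nat q) y ↔
      ∃ a b : ℕ, x = nat a ∧ y = nat b ∧ p * a ≤ q * b := by
  simp only [MulLe, tripleMem_opGraph, pairMem_leGraph]
  constructor
  · rintro ⟨_, _, _, _, ⟨p', a, hp, rfl, rfl⟩, ⟨q', b, hq, rfl, rfl⟩, c, d, hcd, hc, hd⟩
    simp only [nat_inj] at hp hq hc hd
    subst hp hq hc hd
    exact ⟨a, b, rfl, rfl, hcd⟩
  · rintro ⟨a, b, rfl, rfl, h⟩
    exact ⟨_, nat_mem_natSet _, _, nat_mem_natSet _, ⟨p, a, rfl, rfl, rfl⟩, ⟨q, b, rfl, rfl, rfl⟩,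
      _, _, h, rfl, rfl⟩

theorem exists_mem_stage_one {P : V → Prop} (A : Finset ℕ) (h : P (fin A)) :
    ∃ w, Mem w (stage 1) ∧ P w := ⟨_, fin_mem_stage A, h⟩

end V

namespace NonstandardUniverse

variable {U : NonstandardUniverse.{u}}

theorem Transfers.mulLe {α : Type} {s₁ s₂ s₃ s₄ s₅ s₆ s₇ : (α → V) → V}
    {t₁ t₂ t₃ t₄ t₅ t₆ t₇ : (α → U.Obj) → U.Obj} (h₁ : TermTransfers s₁ t₁)
    (h₂ : TermTransfers s₂ t₂) (h₃ : TermTransfers s₃ t₃) (h₄ : TermTransfers s₄ t₄)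
    (h₅ : TermTransfers s₅ t₅) (h₆ : TermTransfers s₆ t₆) (h₇ : TermTransfers s₇ t₇) :
    Transfers (fun v => MulLe V.Mem (s₁ v) (s₂ v) (s₃ v) (s₄ v) (s₅ v) (s₆ v) (s₇ v))
      (fun w => MulLe Mem (t₁ w) (t₂ w) (t₃ w) (t₄ w) (t₅ w) (t₆ w) (t₇ w)) :=
  ex h₁ (ex h₁.weaken (and
    (tripleMem h₂.weaken.weaken h₄.weaken.weaken h₅.weaken.weaken (termTransfers_var (some none)))
    (and (tripleMem h₂.weaken.weaken h₆.weaken.weaken h₇.weaken.weaken (termTransfers_var none))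
      (pairMem h₃.weaken.weaken (termTransfers_var (some none)) (termTransfers_var none)))))

/-- The value at `(x, y)` of the nonstandard extension of the operation `g` on `ℕ` is `z`. -/
abbrev Op (g : ℕ → ℕ → ℕ) (x y z : U.Obj) : Prop := TripleMem Mem (U.star (V.opGraph g)) x y z

/-- The value at `w` of the nonstandard extension of the function `f` on the finite subsets of
`ℕ` is `a`. -/
abbrev FinMap (f : Finset ℕ → ℕ) (w a : U.Obj) : Prop := PairMem Mem (U.star (V.finGraph f)) w a

/-- The order of `*ℕ`. -/
abbrev LE' (a b : U.Obj) : Prop := PairMem Mem (U.star V.leGraph) a b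

/-- The inequality `p * x ≤ q * y` in `*ℕ`, for standard `p` and `q`. -/
abbrev MulLE (p : ℕ) (x : U.Obj) (q : ℕ) (y : U.Obj) : Prop :=
  MulLe Mem (U.star V.natSet) (U.star (V.opGraph (· * ·))) (U.star V.leGraph)
    (U.star (V.nat p)) x (U.star (V.nat q)) y

/-! ## Facts obtained by transfer -/

theorem op_unique (g : ℕ → ℕ → ℕ) (x y z t : U.Obj) :
    Op g x y z → Op g x y t → z = t :=
  Transfers.transfer (P := fun v : Fin 4 → V =>
      TripleMem V.Mem (V.opGraph g) (v 0) (v 1) (v 2) → TripleMem V.Mem (V.opGraph g) (v 0) (v 1)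
      (v 3) → v 2 = v 3)
    (Q := fun w : Fin 4 → U.Obj =>
      Op g (w 0) (w 1) (w 2) → Op g (w 0) (w 1) (w 3) → w 2 = w 3)
    (by
      repeat' first
        | exact termTransfers_var _ | exact termTransfers_const _
        | apply Transfers.tripleMem | apply Transfers.eq | apply Transfers.imp)
    (fun v => by
      simp only [V.tripleMem_opGraph]
      rintro ⟨a, b, ha, hb, h⟩ ⟨c, d, hc, hd, h'⟩
      rw [ha, V.nat_inj] at hc
      rw [hb, V.nat_inj] at hd
      rw [h, h', hc, hd])
    ![x, y, z, t]

theorem op_range (g : ℕ → ℕ → ℕ) (x y z : U.Obj) :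
    Op g x y z → Mem x (U.star V.natSet) ∧ Mem z (U.star V.natSet) :=
  Transfers.transfer (P := fun v : Fin 3 → V =>
      TripleMem V.Mem (V.opGraph g) (v 0) (v 1) (v 2) → V.Mem (v 0) V.natSet ∧ V.Mem (v 2) V.natSet)
    (Q := fun w : Fin 3 → U.Obj =>
      Op g (w 0) (w 1) (w 2) → Mem (w 0) (U.star V.natSet) ∧ Mem (w 2) (U.star V.natSet))
    (by
      repeat' first
        | exact termTransfers_var _ | exact termTransfers_const _
        | apply Transfers.tripleMem | apply Transfers.mem | apply Transfers.imp
        | apply Transfers.and)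
    (fun v => by
      simp only [V.mem_natSet, V.tripleMem_opGraph]
      rintro ⟨a, b, ha, hb, h⟩
      exact ⟨⟨_, ha⟩, _, h⟩)
    ![x, y, z]

theorem le_zero (x : U.Obj) :
    LE' x (U.star (V.nat 0)) → x = U.star (V.nat 0) :=
  Transfers.transfer (P := fun v : Fin 1 → V =>
      PairMem V.Mem V.leGraph (v 0) (V.nat 0) → v 0 = V.nat 0)
    (Q := fun w : Fin 1 → U.Obj =>
      LE' (w 0) (U.star (V.nat 0)) → w 0 = U.star (V.nat 0))
    (by
      repeat' first
        | exact termTransfers_var _ | exact termTransfers_const _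
        | apply Transfers.pairMem | apply Transfers.eq | apply Transfers.imp)
    (fun v => by
      simp only [V.pairMem_leGraph]
      rintro ⟨a, b, hab, h, h'⟩
      rw [V.nat_inj] at h'
      rw [h, show a = 0 by omega])
    ![x]

theorem le_succ (n : ℕ) (x : U.Obj) :
    LE' x (U.star (V.nat (n + 1))) → LE' x (U.star (V.nat n)) ∨
      x = U.star (V.nat (n + 1)) :=
  Transfers.transfer (P := fun v : Fin 1 → V =>
      PairMem V.Mem V.leGraph (v 0) (V.nat (n + 1)) → PairMem V.Mem V.leGraph (v 0) (V.nat n) ∨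
      (v 0) = V.nat (n + 1))
    (Q := fun w : Fin 1 → U.Obj =>
      LE' (w 0) (U.star (V.nat (n + 1))) → LE' (w 0) (U.star (V.nat n)) ∨ (w 0) = U.star
      (V.nat (n + 1)))
    (by
      repeat' first
        | exact termTransfers_var _ | exact termTransfers_const _
        | apply Transfers.pairMem | apply Transfers.eq | apply Transfers.imp | apply Transfers.or)
    (fun v => by
      simp only [V.pairMem_leGraph]
      rintro ⟨a, b, hab, h, h'⟩
      rw [V.nat_inj] at h'
      rcases Nat.lt_or_ge n a with hn | hn
      · right
        rw [h, show a = n + 1 by omega]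
      · exact .inl ⟨a, n, hn, h, rfl⟩)
    ![x]

theorem le_total' (n : ℕ) (x : U.Obj) :
    Mem x (U.star V.natSet) → LE' (U.star (V.nat n)) x ∨ LE' x (U.star (V.nat n)) :=
  Transfers.transfer (P := fun v : Fin 1 → V =>
      V.Mem (v 0) V.natSet → PairMem V.Mem V.leGraph (V.nat n) (v 0) ∨ PairMem V.Mem V.leGraph
      (v 0) (V.nat n))
    (Q := fun w : Fin 1 → U.Obj =>
      Mem (w 0) (U.star V.natSet) → LE' (U.star (V.nat n)) (w 0) ∨ LE' (w 0) (U.star (V.nat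
      n)))
    (by
      repeat' first
        | exact termTransfers_var _ | exact termTransfers_const _
        | apply Transfers.pairMem | apply Transfers.mem | apply Transfers.imp | apply Transfers.or)
    (fun v => by
      simp only [V.mem_natSet, V.pairMem_leGraph]
      rintro ⟨a, ha⟩
      rcases le_total n a with hn | hn
      · exact .inl ⟨n, a, hn, rfl, ha⟩
      · exact .inr ⟨a, n, hn, ha, rfl⟩)
    ![x]

theorem exists_card_inter (w₀ a₀ s : U.Obj) :
    FinMap Finset.card w₀ a₀ → ∃ w₁, Mem w₁ (U.star (V.stage 1)) ∧ ∃ a₁, Mem a₁ (U.star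
    V.natSet) ∧ FinMap Finset.card w₁ a₁ ∧ (∀ x, Mem x w₁ → Mem x w₀ ∧ Mem x s) ∧ ∀ x, Mem x
    w₀ → Mem x s → Mem x w₁ :=
  Transfers.transfer (P := fun v : Fin 3 → V =>
      PairMem V.Mem (V.finGraph Finset.card) (v 0) (v 1) → ∃ w₁, V.Mem w₁ (V.stage 1) ∧ ∃ a₁,
      V.Mem a₁ V.natSet ∧ PairMem V.Mem (V.finGraph Finset.card) w₁ a₁ ∧ (∀ x, V.Mem x w₁ →
      V.Mem x (v 0) ∧ V.Mem x (v 2)) ∧ ∀ x, V.Mem x (v 0) → V.Mem x (v 2) → V.Mem x w₁)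
    (Q := fun w : Fin 3 → U.Obj =>
      FinMap Finset.card (w 0) (w 1) → ∃ w₁, Mem w₁ (U.star (V.stage 1)) ∧ ∃ a₁, Mem a₁
      (U.star V.natSet) ∧ FinMap Finset.card w₁ a₁ ∧ (∀ x, Mem x w₁ → Mem x (w 0) ∧ Mem x (w 2))
      ∧ ∀ x, Mem x (w 0) → Mem x (w 2) → Mem x w₁)
    (by
      repeat' first
        | exact termTransfers_var _ | exact termTransfers_const _
        | apply Transfers.pairMem | apply Transfers.mem | apply Transfers.ex | apply Transfers.all
        | apply Transfers.imp | apply Transfers.and)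
    (fun v => by
      classical
      simp only [V.mem_natSet, V.pairMem_finGraph]
      rintro ⟨A, hA, -⟩
      rw [hA]
      refine V.exists_mem_stage_one {a ∈ A | V.Mem (V.nat a) (v 2)}
        ⟨_, ⟨_, rfl⟩, ⟨_, rfl, rfl⟩, fun x hx => ?_, fun x hx hs => ?_⟩
      · obtain ⟨a, ha, rfl⟩ := V.mem_fin.1 hx
        rw [Finset.mem_filter] at ha
        exact ⟨V.nat_mem_fin.2 ha.1, ha.2⟩
      · obtain ⟨a, ha, rfl⟩ := V.mem_fin.1 hx
        exact V.nat_mem_fin.2 (Finset.mem_filter.2 ⟨ha, hs⟩))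
    ![w₀, a₀, s]

theorem exists_card_diff (w₀ a₀ s : U.Obj) :
    FinMap Finset.card w₀ a₀ → ∃ w₁, Mem w₁ (U.star (V.stage 1)) ∧ ∃ a₁, Mem a₁ (U.star
    V.natSet) ∧ FinMap Finset.card w₁ a₁ ∧ (∀ x, Mem x w₁ → Mem x w₀ ∧ ¬ Mem x s) ∧ ∀ x, Mem x
    w₀ → ¬ Mem x s → Mem x w₁ :=
  Transfers.transfer (P := fun v : Fin 3 → V =>
      PairMem V.Mem (V.finGraph Finset.card) (v 0) (v 1) → ∃ w₁, V.Mem w₁ (V.stage 1) ∧ ∃ a₁,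
      V.Mem a₁ V.natSet ∧ PairMem V.Mem (V.finGraph Finset.card) w₁ a₁ ∧ (∀ x, V.Mem x w₁ →
      V.Mem x (v 0) ∧ ¬ V.Mem x (v 2)) ∧ ∀ x, V.Mem x (v 0) → ¬ V.Mem x (v 2) → V.Mem x w₁)
    (Q := fun w : Fin 3 → U.Obj =>
      FinMap Finset.card (w 0) (w 1) → ∃ w₁, Mem w₁ (U.star (V.stage 1)) ∧ ∃ a₁, Mem a₁
      (U.star V.natSet) ∧ FinMap Finset.card w₁ a₁ ∧ (∀ x, Mem x w₁ → Mem x (w 0) ∧ ¬ Mem x (w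
      2)) ∧ ∀ x, Mem x (w 0) → ¬ Mem x (w 2) → Mem x w₁)
    (by
      repeat' first
        | exact termTransfers_var _ | exact termTransfers_const _
        | apply Transfers.pairMem | apply Transfers.mem | apply Transfers.not | apply Transfers.ex
        | apply Transfers.all | apply Transfers.imp | apply Transfers.and)
    (fun v => by
      classical
      simp only [V.mem_natSet, V.pairMem_finGraph]
      rintro ⟨A, hA, -⟩
      rw [hA]
      refine V.exists_mem_stage_one {a ∈ A | ¬ V.Mem (V.nat a) (v 2)}
        ⟨_, ⟨_, rfl⟩, ⟨_, rfl, rfl⟩, fun x hx => ?_, fun x hx hs => ?_⟩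
      · obtain ⟨a, ha, rfl⟩ := V.mem_fin.1 hx
        rw [Finset.mem_filter] at ha
        exact ⟨V.nat_mem_fin.2 ha.1, ha.2⟩
      · obtain ⟨a, ha, rfl⟩ := V.mem_fin.1 hx
        exact V.nat_mem_fin.2 (Finset.mem_filter.2 ⟨ha, hs⟩))
    ![w₀, a₀, s]

/-- Rational lower bounds `p / q` and `p' / q'` for the measures of two disjoint pieces add up to
one for the whole; this is the source of superadditivity. -/
theorem mulLE_of_card (p q p' q' : ℕ) (w₀ a₀ w₁ a₁ w₂ a₂ h : U.Obj) :
    FinMap Finset.card w₀ a₀ → FinMap Finset.card w₁ a₁ → FinMap Finset.card w₂ a₂ → (∀ x,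
    Mem x w₁ → Mem x w₀) → (∀ x, Mem x w₂ → Mem x w₀ ∧ ¬ Mem x w₁) → MulLE p h q a₁ → MulLE
    (p') h (q') a₂ → MulLE (p * q' + p' * q) h (q * q') a₀ :=
  Transfers.transfer (P := fun v : Fin 7 → V =>
      PairMem V.Mem (V.finGraph Finset.card) (v 0) (v 1) → PairMem V.Mem (V.finGraph
      Finset.card) (v 2) (v 3) → PairMem V.Mem (V.finGraph Finset.card) (v 4) (v 5) → (∀ x,
      V.Mem x (v 2) → V.Mem x (v 0)) → (∀ x, V.Mem x (v 4) → V.Mem x (v 0) ∧ ¬ V.Mem x (v 2)) →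
      MulLe V.Mem V.natSet (V.opGraph (· * ·)) V.leGraph (V.nat p) (v 6) (V.nat q) (v 3) →
      MulLe V.Mem V.natSet (V.opGraph (· * ·)) V.leGraph (V.nat (p')) (v 6) (V.nat (q')) (v 5) →
      MulLe V.Mem V.natSet (V.opGraph (· * ·)) V.leGraph (V.nat (p * q' + p' * q)) (v 6) (V.nat (q
      * q')) (v 1))
    (Q := fun w : Fin 7 → U.Obj =>
      FinMap Finset.card (w 0) (w 1) → FinMap Finset.card (w 2) (w 3) → FinMap Finset.card
      (w 4) (w 5) → (∀ x, Mem x (w 2) → Mem x (w 0)) → (∀ x, Mem x (w 4) → Mem x (w 0) ∧ ¬ Mem x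
      (w 2)) → MulLE p (w 6) q (w 3) → MulLE p' (w 6) q' (w 5) → MulLE (p * q' + p' * q)
      (w 6) (q * q') (w 1))
    (by
      repeat' first
        | exact termTransfers_var _ | exact termTransfers_const _
        | apply Transfers.pairMem | apply Transfers.mulLe | apply Transfers.mem
        | apply Transfers.not
        | apply Transfers.all | apply Transfers.imp | apply Transfers.and)
    (fun v => by
      simp only [V.pairMem_finGraph, V.mulLe_iff]
      rintro ⟨A, hA, hA'⟩ ⟨B, hB, hB'⟩ ⟨C, hC, hC'⟩ hBA hCA ⟨m, b, hm, hb, hmb⟩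
        ⟨m', c, hm', hc, hmc⟩
      rw [hB, hA] at hBA
      rw [hC, hA, hB] at hCA
      rw [hB', V.nat_inj] at hb
      rw [hC', V.nat_inj] at hc
      rw [hm, V.nat_inj] at hm'
      subst hm' hb hc
      have h₁ : B.card + C.card ≤ A.card := by
        rw [← Finset.card_union_of_disjoint (Finset.disjoint_right.2 fun x hx =>
          mt V.nat_mem_fin.2 (hCA _ (V.nat_mem_fin.2 hx)).2)]
        exact Finset.card_le_card (Finset.union_subset
          (fun x hx => V.nat_mem_fin.1 (hBA _ (V.nat_mem_fin.2 hx)))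
          (fun x hx => V.nat_mem_fin.1 (hCA _ (V.nat_mem_fin.2 hx)).1))
      refine ⟨m, _, hm, hA', ?_⟩
      calc (p * q' + p' * q) * m = (p * m) * q' + (p' * m) * q := by ring
        _ ≤ (q * B.card) * q' + (q' * C.card) * q := by gcongr
        _ = q * q' * (B.card + C.card) := by ring
        _ ≤ q * q' * A.card := by gcongr)
    ![w₀, a₀, w₁, a₁, w₂, a₂, h]

theorem exists_card_Icc (h : U.Obj) :
    Mem h (U.star V.natSet) → ∃ w₀, Mem w₀ (U.star (V.stage 1)) ∧ FinMap Finset.card w₀ h ∧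
    (∀ x, Mem x w₀ → Mem x (U.star V.natSet) ∧ LE' (U.star (V.nat 1)) x ∧ LE' x h) ∧ ∀ x,
    Mem x (U.star V.natSet) → LE' (U.star (V.nat 1)) x → LE' x h → Mem x w₀ :=
  Transfers.transfer (P := fun v : Fin 1 → V =>
      V.Mem (v 0) V.natSet → ∃ w₀, V.Mem w₀ (V.stage 1) ∧ PairMem V.Mem (V.finGraph
      Finset.card) w₀ (v 0) ∧ (∀ x, V.Mem x w₀ → V.Mem x V.natSet ∧ PairMem V.Mem V.leGraph
      (V.nat 1) x ∧ PairMem V.Mem V.leGraph x (v 0)) ∧ ∀ x, V.Mem x V.natSet → PairMem V.Mem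
      V.leGraph (V.nat 1) x → PairMem V.Mem V.leGraph x (v 0) → V.Mem x w₀)
    (Q := fun w : Fin 1 → U.Obj =>
      Mem (w 0) (U.star V.natSet) → ∃ w₀, Mem w₀ (U.star (V.stage 1)) ∧ FinMap Finset.card w₀
      (w 0) ∧ (∀ x, Mem x w₀ → Mem x (U.star V.natSet) ∧ LE' (U.star (V.nat 1)) x ∧ LE' x (w
      0)) ∧ ∀ x, Mem x (U.star V.natSet) → LE' (U.star (V.nat 1)) x → LE' x (w 0) → Mem x w₀)
    (by
      repeat' first
        | exact termTransfers_var _ | exact termTransfers_const _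
        | apply Transfers.pairMem | apply Transfers.mem | apply Transfers.ex | apply Transfers.all
        | apply Transfers.imp | apply Transfers.and)
    (fun v => by
      simp only [V.mem_natSet, V.pairMem_finGraph, V.pairMem_leGraph]
      rintro ⟨m, hm⟩
      rw [hm]
      refine V.exists_mem_stage_one (Finset.Icc 1 m) ⟨⟨_, rfl, by simp⟩, fun x hx => ?_, ?_⟩
      · obtain ⟨a, ha, rfl⟩ := V.mem_fin.1 hx
        rw [Finset.mem_Icc] at ha
        exact ⟨⟨a, rfl⟩, ⟨1, a, ha.1, rfl, rfl⟩, a, m, ha.2, rfl, rfl⟩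
      · rintro x ⟨a, rfl⟩ ⟨b, c, hbc, hb, hc⟩ ⟨d, e, hde, hd, he⟩
        rw [V.nat_inj] at hb hc hd he
        rw [V.nat_mem_fin, Finset.mem_Icc]
        omega)
    ![h]

theorem eq_zero_of_mulLE {p q r s : ℕ} (hpq : ¬ p * r ≤ q * s) (x y : U.Obj) :
    MulLE p x q y → MulLE r y s x → x = U.star (V.nat 0) :=
  Transfers.transfer (P := fun v : Fin 2 → V =>
      MulLe V.Mem V.natSet (V.opGraph (· * ·)) V.leGraph (V.nat p) (v 0) (V.nat q) (v 1) →
      MulLe V.Mem V.natSet (V.opGraph (· * ·)) V.leGraph (V.nat r) (v 1) (V.nat s) (v 0) → (v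
      0) = V.nat 0)
    (Q := fun w : Fin 2 → U.Obj =>
      MulLE p (w 0) q (w 1) → MulLE r (w 1) s (w 0) → w 0 = U.star (V.nat 0))
    (by
      repeat' first
        | exact termTransfers_var _ | exact termTransfers_const _
        | apply Transfers.mulLe | apply Transfers.eq | apply Transfers.imp)
    (fun v => by
      simp only [V.mulLe_iff]
      rintro ⟨a, b, ha, hb, hab⟩ ⟨c, d, hc, hd, hcd⟩
      rw [hb, V.nat_inj] at hc
      rw [ha, V.nat_inj] at hd
      subst hc hd
      rw [ha, V.nat_inj]
      by_contra h0
      refine hpq (Nat.le_of_mul_le_mul_right ?_ (Nat.pos_of_ne_zero h0))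
      calc p * r * a = r * (p * a) := by ring
        _ ≤ r * (q * b) := by gcongr
        _ = q * (r * b) := by ring
        _ ≤ q * (s * a) := by gcongr
        _ = q * s * a := by ring)
    ![x, y]

theorem mulLE_zero (f : Finset ℕ → ℕ) (w₀ a₀ h : U.Obj) :
    FinMap f w₀ a₀ → Mem h (U.star V.natSet) → MulLE 0 h 1 a₀ :=
  Transfers.transfer (P := fun v : Fin 3 → V =>
      PairMem V.Mem (V.finGraph f) (v 0) (v 1) → V.Mem (v 2) V.natSet →
      MulLe V.Mem V.natSet (V.opGraph (· * ·)) V.leGraph (V.nat 0) (v 2) (V.nat 1) (v 1))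
    (Q := fun w : Fin 3 → U.Obj =>
      FinMap f (w 0) (w 1) → Mem (w 2) (U.star V.natSet) → MulLE 0 (w 2) 1 (w 1))
    (by
      repeat' first
        | exact termTransfers_var _ | exact termTransfers_const _
        | apply Transfers.pairMem | apply Transfers.mulLe | apply Transfers.mem
        | apply Transfers.imp)
    (fun v => by
      simp only [V.mem_natSet, V.pairMem_finGraph, V.mulLe_iff]
      rintro ⟨A, -, hA⟩ ⟨m, hm⟩
      exact ⟨m, _, hm, hA, by simp⟩)
    ![w₀, a₀, h]

theorem mulLE_refl (p : ℕ) (x : U.Obj) :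
    Mem x (U.star V.natSet) → MulLE p x p x :=
  Transfers.transfer (P := fun v : Fin 1 → V =>
      V.Mem (v 0) V.natSet → MulLe V.Mem V.natSet (V.opGraph (· * ·)) V.leGraph (V.nat p) (v
      0) (V.nat p) (v 0))
    (Q := fun w : Fin 1 → U.Obj =>
      Mem (w 0) (U.star V.natSet) → MulLE p (w 0) p (w 0))
    (by
      repeat' first
        | exact termTransfers_var _ | exact termTransfers_const _
        | apply Transfers.mulLe | apply Transfers.mem | apply Transfers.imp)
    (fun v => by
      simp only [V.mem_natSet, V.mulLe_iff]
      rintro ⟨a, ha⟩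
      exact ⟨a, a, ha, ha, le_rfl⟩)
    ![x]

/-- A value under `f` only certifies that `w₀` is a hyperfinite set; with `g` an encoding this
yields hypernatural codes. -/
theorem exists_finMap (f g : Finset ℕ → ℕ) (w₀ a₀ : U.Obj) :
    FinMap f w₀ a₀ → ∃ k, Mem k (U.star V.natSet) ∧ FinMap g w₀ k :=
  Transfers.transfer (P := fun v : Fin 2 → V =>
      PairMem V.Mem (V.finGraph f) (v 0) (v 1) → ∃ k, V.Mem k V.natSet ∧ PairMem V.Mem
      (V.finGraph g) (v 0) k)
    (Q := fun w : Fin 2 → U.Obj =>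
      FinMap f (w 0) (w 1) → ∃ k, Mem k (U.star V.natSet) ∧ FinMap g (w 0) k)
    (by
      repeat' first
        | exact termTransfers_var _ | exact termTransfers_const _
        | apply Transfers.pairMem | apply Transfers.mem | apply Transfers.ex | apply Transfers.imp)
    (fun v => by
      simp only [V.mem_natSet, V.pairMem_finGraph]
      rintro ⟨A, hA, -⟩
      exact ⟨_, ⟨_, rfl⟩, A, hA, rfl⟩)
    ![w₀, a₀]

theorem finMap_injective {f : Finset ℕ → ℕ} (hf : Function.Injective f) (w₀ w₁ k : U.Obj) :
    FinMap f w₀ k → FinMap f w₁ k → w₀ = w₁ :=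
  Transfers.transfer (P := fun v : Fin 3 → V =>
      PairMem V.Mem (V.finGraph f) (v 0) (v 2) → PairMem V.Mem (V.finGraph f) (v 1) (v 2) → (v 0)
      = v 1)
    (Q := fun w : Fin 3 → U.Obj =>
      FinMap f (w 0) (w 2) → FinMap f (w 1) (w 2) → w 0 = w 1)
    (by
      repeat' first
        | exact termTransfers_var _ | exact termTransfers_const _
        | apply Transfers.pairMem | apply Transfers.eq | apply Transfers.imp)
    (fun v => by
      simp only [V.pairMem_finGraph]
      rintro ⟨A, hA, hk⟩ ⟨B, hB, hk'⟩
      rw [hk, V.nat_inj] at hk'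
      rw [hA, hB, hf hk'])
    ![w₀, w₁, k]

theorem digitGuard_nat (n m : ℕ) (h : U.Obj) :
    LE' (U.star ((V.nat ((n + 2) ^ (m + 1))))) h → Op (digitGuard n) (U.star (V.nat m)) h
    (U.star (V.nat 1)) :=
  Transfers.transfer (P := fun v : Fin 1 → V =>
      PairMem V.Mem V.leGraph (V.nat ((n + 2) ^ (m + 1))) (v 0) → TripleMem V.Mem (V.opGraph
      (digitGuard n)) (V.nat m) (v 0) (V.nat 1))
    (Q := fun w : Fin 1 → U.Obj =>
      LE' (U.star ((V.nat ((n + 2) ^ (m + 1))))) (w 0) → Op (digitGuard n) (U.star (V.nat m))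
      (w 0) (U.star (V.nat 1)))
    (by
      repeat' first
        | exact termTransfers_var _ | exact termTransfers_const _
        | apply Transfers.pairMem | apply Transfers.tripleMem | apply Transfers.imp)
    (fun v => by
      simp only [V.tripleMem_opGraph, V.pairMem_leGraph]
      rintro ⟨a, b, hab, ha, hb⟩
      rw [V.nat_inj] at ha
      refine ⟨m, b, rfl, hb, ?_⟩
      rw [digitGuard, if_pos (ha ▸ hab)])
    ![h]

theorem exists_digitGuard_ne (n : ℕ) (h i : U.Obj) :
    Mem h (U.star V.natSet) → ∃ w₀, Mem w₀ (U.star (V.stage 1)) ∧ (∀ x, Mem x w₀ → Op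
    (digitGuard n) x h (U.star (V.nat 1)) ∧ x ≠ i) ∧ ∀ x, Mem x (U.star V.natSet) → Op
    (digitGuard n) x h (U.star (V.nat 1)) → x ≠ i → Mem x w₀ :=
  Transfers.transfer (P := fun v : Fin 2 → V =>
      V.Mem (v 0) V.natSet → ∃ w₀, V.Mem w₀ (V.stage 1) ∧ (∀ x, V.Mem x w₀ → TripleMem V.Mem
      (V.opGraph (digitGuard n)) x (v 0) (V.nat 1) ∧ x ≠ (v 1)) ∧ ∀ x, V.Mem x V.natSet →
      TripleMem V.Mem (V.opGraph (digitGuard n)) x (v 0) (V.nat 1) → x ≠ (v 1) → V.Mem x w₀)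
    (Q := fun w : Fin 2 → U.Obj =>
      Mem (w 0) (U.star V.natSet) → ∃ w₀, Mem w₀ (U.star (V.stage 1)) ∧ (∀ x, Mem x w₀ → Op
      (digitGuard n) x (w 0) (U.star (V.nat 1)) ∧ x ≠ (w 1)) ∧ ∀ x, Mem x (U.star V.natSet) →
      Op (digitGuard n) x (w 0) (U.star (V.nat 1)) → x ≠ (w 1) → Mem x w₀)
    (by
      repeat' first
        | exact termTransfers_var _ | exact termTransfers_const _
        | apply Transfers.tripleMem | apply Transfers.mem | apply Transfers.eq | apply Transfers.not
        | apply Transfers.ex | apply Transfers.all | apply Transfers.imp | apply Transfers.and)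
    (fun v => by
      classical
      simp only [V.mem_natSet, V.tripleMem_opGraph]
      rintro ⟨m, hm⟩
      rw [hm]
      -- The guard bounds the places: `a < (n + 2) ^ a ≤ (n + 2) ^ (a + 1) ≤ m`.
      refine V.exists_mem_stage_one {a ∈ Finset.range m | digitGuard n a m = 1 ∧ V.nat a ≠ v 1}
        ⟨fun x hx => ?_, ?_⟩
      · obtain ⟨a, ha, rfl⟩ := V.mem_fin.1 hx
        rw [Finset.mem_filter] at ha
        exact ⟨⟨a, m, rfl, rfl, by rw [ha.2.1]⟩, ha.2.2⟩
      · rintro x ⟨a, rfl⟩ ⟨b, c, hb, hc, hd⟩ hi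
        rw [V.nat_inj] at hb hc hd
        subst hb hc
        rw [V.nat_mem_fin, Finset.mem_filter, Finset.mem_range]
        refine ⟨?_, hd.symm, hi⟩
        rw [digitGuard] at hd
        split_ifs at hd with h
        exact (Nat.lt_pow_self (by omega)).trans_le
          (le_trans (Nat.pow_le_pow_right (by omega) (Nat.le_succ a)) h))
    ![h, i]

theorem exists_digit (n : ℕ) (i x : U.Obj) :
    Mem i (U.star V.natSet) → Mem x (U.star V.natSet) → ∃ t, Mem t (U.star V.natSet) ∧ Op (digit
    n) i x t ∧ LE' t (U.star (V.nat (n + 1))) :=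
  Transfers.transfer (P := fun v : Fin 2 → V =>
      V.Mem (v 0) V.natSet → V.Mem (v 1) V.natSet → ∃ t, V.Mem t V.natSet ∧ TripleMem V.Mem
      (V.opGraph (digit n)) (v 0) (v 1) t ∧ PairMem V.Mem V.leGraph t (V.nat (n + 1)))
    (Q := fun w : Fin 2 → U.Obj =>
      Mem (w 0) (U.star V.natSet) → Mem (w 1) (U.star V.natSet) → ∃ t, Mem t (U.star V.natSet) ∧
      Op (digit n) (w 0) (w 1) t ∧ LE' t (U.star (V.nat (n + 1))))
    (by
      repeat' first
        | exact termTransfers_var _ | exact termTransfers_const _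
        | apply Transfers.pairMem | apply Transfers.tripleMem | apply Transfers.mem
        | apply Transfers.ex
        | apply Transfers.imp | apply Transfers.and)
    (fun v => by
      simp only [V.mem_natSet, V.tripleMem_opGraph, V.pairMem_leGraph]
      rintro ⟨a, ha⟩ ⟨b, hb⟩
      exact ⟨_, ⟨digit n a b, rfl⟩, ⟨a, b, ha, hb, rfl⟩, _, n + 1,
        Nat.lt_succ_iff.1 (Nat.mod_lt _ (Nat.succ_pos _)), rfl, rfl⟩)
    ![i, x]

theorem exists_sameDigit (n : ℕ) (h i j : U.Obj) :
    Op (digitGuard n) j h (U.star (V.nat 1)) → Mem i (U.star V.natSet) → i ≠ j → ∃ w₀, Mem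
    w₀ (U.star (V.stage 1)) ∧ ∃ a₀, Mem a₀ (U.star V.natSet) ∧ FinMap Finset.card w₀ a₀ ∧
    MulLE (n + 2) a₀ 3 h ∧ (∀ x, Mem x w₀ → Mem x (U.star V.natSet) ∧ LE' (U.star (V.nat
    1)) x ∧ LE' x h ∧ ∃ t, Mem t (U.star V.natSet) ∧ Op (digit n) i x t ∧ Op (digit n) j x t)
    ∧ ∀ x, Mem x (U.star V.natSet) → LE' (U.star (V.nat 1)) x → LE' x h → (∃ t, Mem t
    (U.star V.natSet) ∧ Op (digit n) i x t ∧ Op (digit n) j x t) → Mem x w₀ :=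
  Transfers.transfer (P := fun v : Fin 3 → V =>
      TripleMem V.Mem (V.opGraph (digitGuard n)) (v 2) (v 0) (V.nat 1) → V.Mem (v 1) V.natSet
      → v 1 ≠ (v 2) → ∃ w₀, V.Mem w₀ (V.stage 1) ∧ ∃ a₀, V.Mem a₀ V.natSet ∧ PairMem V.Mem
      (V.finGraph Finset.card) w₀ a₀ ∧ MulLe V.Mem V.natSet (V.opGraph (· * ·)) V.leGraph (V.nat
      (n + 2)) a₀ (V.nat 3) (v 0) ∧ (∀ x, V.Mem x w₀ → V.Mem x V.natSet ∧ PairMem V.Mem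
      V.leGraph (V.nat 1) x ∧ PairMem V.Mem V.leGraph x (v 0) ∧ ∃ t, V.Mem t V.natSet ∧
      TripleMem V.Mem (V.opGraph (digit n)) (v 1) x t ∧ TripleMem V.Mem (V.opGraph (digit n)) (v
      2) x t) ∧ ∀ x, V.Mem x V.natSet → PairMem V.Mem V.leGraph (V.nat 1) x → PairMem V.Mem
      V.leGraph x (v 0) → (∃ t, V.Mem t V.natSet ∧ TripleMem V.Mem (V.opGraph (digit n)) (v 1) x
      t ∧ TripleMem V.Mem (V.opGraph (digit n)) (v 2) x t) → V.Mem x w₀)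
    (Q := fun w : Fin 3 → U.Obj =>
      Op (digitGuard n) (w 2) (w 0) (U.star (V.nat 1)) → Mem (w 1) (U.star V.natSet) → w 1 ≠
      (w 2) → ∃ w₀, Mem w₀ (U.star (V.stage 1)) ∧ ∃ a₀, Mem a₀ (U.star V.natSet) ∧ FinMap
      Finset.card w₀ a₀ ∧ MulLE (n + 2) a₀ 3 (w 0) ∧ (∀ x, Mem x w₀ → Mem x (U.star V.natSet)
      ∧ LE' (U.star (V.nat 1)) x ∧ LE' x (w 0) ∧ ∃ t, Mem t (U.star V.natSet) ∧ Op (digit n)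
      (w 1) x t ∧ Op (digit n) (w 2) x t) ∧ ∀ x, Mem x (U.star V.natSet) → LE' (U.star (V.nat
      1)) x → LE' x (w 0) → (∃ t, Mem t (U.star V.natSet) ∧ Op (digit n) (w 1) x t ∧ Op (digit
      n) (w 2) x t) → Mem x w₀)
    (by
      repeat' first
        | exact termTransfers_var _ | exact termTransfers_const _
        | apply Transfers.pairMem | apply Transfers.tripleMem | apply Transfers.mulLe
        | apply Transfers.mem
        | apply Transfers.eq | apply Transfers.not | apply Transfers.ex | apply Transfers.all
        | apply Transfers.imp | apply Transfers.and)
    (fun v => by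
      simp only [V.mem_natSet, V.tripleMem_opGraph, V.pairMem_finGraph,
        V.pairMem_leGraph, V.mulLe_iff]
      rintro ⟨j, m, hj, hm, hg⟩ ⟨i, hi⟩ hij
      rw [hi, hj, Ne, V.nat_inj] at hij
      rw [hi, hj, hm]
      rw [V.nat_inj, digitGuard] at hg
      split_ifs at hg with hle
      · refine V.exists_mem_stage_one (sameDigit n m i j) ⟨_, ⟨_, rfl⟩, ⟨_, rfl, rfl⟩,
          ⟨_, m, rfl, rfl, (mul_comm _ _).trans_le (card_sameDigit_mul_le hij hle)⟩,
          fun x hx => ?_, ?_⟩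
        · obtain ⟨a, ha, rfl⟩ := V.mem_fin.1 hx
          rw [sameDigit, Finset.mem_filter, Finset.mem_Icc] at ha
          exact ⟨⟨a, rfl⟩, ⟨1, a, ha.1.1, rfl, rfl⟩, ⟨a, m, ha.1.2, rfl, rfl⟩, _, ⟨_, rfl⟩,
            ⟨i, a, rfl, rfl, rfl⟩, j, a, rfl, rfl, congrArg _ ha.2⟩
        · rintro x ⟨a, rfl⟩ ⟨b, c, hbc, hb, hc⟩ ⟨d, e, hde, hd, he⟩
            ⟨_, _, ⟨i', x', hi', hx', h₁⟩, j', x'', hj', hx'', h₂⟩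
          rw [V.nat_inj] at hb hc hd he hi' hj' hx' hx''
          rw [h₁, V.nat_inj] at h₂
          subst hi' hj' hx' hx''
          rw [V.nat_mem_fin, sameDigit, Finset.mem_filter, Finset.mem_Icc]
          exact ⟨⟨by omega, by omega⟩, h₂⟩)
    ![h, i, j]

end NonstandardUniverse

namespace NonstandardUniverse

variable {U : NonstandardUniverse.{u}}

/-! ## Hypernatural numbers -/

theorem star_nat_injective : Function.Injective fun k => U.star (V.nat k) := fun _ _ h =>
  V.nat_injective (U.emb.injective (congrArg Subtype.val h))

/-- Initial segments below standard numbers gain no elements, by external induction on the standard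
bound. -/
theorem exists_eq_star_of_le (n : ℕ) {x : U.Obj} (h : LE' x (U.star (V.nat n))) :
    ∃ k ≤ n, x = U.star (V.nat k) := by
  induction n with
  | zero => exact ⟨0, le_rfl, le_zero x h⟩
  | succ n ih =>
    rcases le_succ n x h with h | h
    · obtain ⟨k, hk, rfl⟩ := ih h
      exact ⟨k, hk.trans n.le_succ, rfl⟩
    · exact ⟨n + 1, le_rfl, h⟩

theorem IsHyperfinite.star_le {H : U.Obj} (hH : U.IsHyperfinite H) (n : ℕ) :
    LE' (U.star (V.nat n)) H := by
  rcases le_total' n H hH.1 with h | h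
  · exact h
  · obtain ⟨k, _, rfl⟩ := exists_eq_star_of_le n h
    exact absurd rfl (hH.2 k)

/-! ## Standard parts of quotients -/

theorem exists_isMul_iff {p q : ℕ} {H a : U.Obj} :
    (∃ b c, IsMul (U.star (V.nat p)) H b ∧ IsMul (U.star (V.nat q)) a c ∧ Le b c) ↔
      MulLE p H q a := by
  simp only [isMul_iff, le_iff, MulLe]
  constructor
  · rintro ⟨b, c, hb, hc, h⟩
    exact ⟨b, (op_range _ _ _ _ hb).2, c, (op_range _ _ _ _ hc).2, hb, hc, h⟩
  · rintro ⟨b, _, c, _, hb, hc, h⟩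
    exact ⟨b, c, hb, hc, h⟩

theorem stDiv_eq (a H : U.Obj) :
    stDiv a H = ⨆ pq : ℕ × ℕ, ⨆ _ : 0 < pq.2 ∧ MulLE pq.1 H pq.2 a,
      (pq.1 : ℝ≥0∞) / (pq.2 : ℝ≥0∞) := by
  simp only [stDiv, exists_isMul_iff]
  apply le_antisymm
  · refine sSup_le ?_
    rintro _ ⟨p, q, hq, rfl, h⟩
    exact le_iSup₂_of_le (p, q) ⟨hq, h⟩ le_rfl
  · exact iSup₂_le fun pq h => le_sSup ⟨pq.1, pq.2, h.1, rfl, h.2⟩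

theorem stDiv_le {a H : U.Obj} (hH : U.IsHyperfinite H) {r s : ℕ} (hr : 0 < r)
    (h : MulLE r a s H) : stDiv a H ≤ (s : ℝ≥0∞) / (r : ℝ≥0∞) := by
  rw [stDiv_eq]
  refine iSup₂_le fun pq hpq => ?_
  -- Chaining the two inequalities compares `pq.1 * r` with `pq.2 * s` after multiplication by `H`,
  -- which is not zero.
  have key : pq.1 * r ≤ pq.2 * s := by
    by_contra hn
    exact hH.2 0 (eq_zero_of_mulLE hn _ _ hpq.2 h)
  refine ENNReal.div_le_of_le_mul ?_
  rw [ENNReal.mul_div_right_comm.symm, ENNReal.le_div_iff_mul_le (by simp [hr.ne']) (by simp)]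
  rw [mul_comm (s : ℝ≥0∞)]
  exact_mod_cast key

theorem stDiv_add_le {w a w₁ a₁ w₂ a₂ H : U.Obj} (hH : U.IsHyperfinite H)
    (h : FinMap Finset.card w a) (h₁ : FinMap Finset.card w₁ a₁) (h₂ : FinMap Finset.card w₂ a₂)
    (hw₁ : ∀ x, Mem x w₁ → Mem x w) (hw₂ : ∀ x, Mem x w₂ → Mem x w ∧ ¬ Mem x w₁) :
    stDiv a₁ H + stDiv a₂ H ≤ stDiv a H := by
  rw [stDiv_eq a₁, stDiv_eq a₂]
  -- The trivial bound `0 / 1` shows that both suprema range over nonempty sets.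
  refine ENNReal.biSup_add_biSup_le' ⟨(0, 1), one_pos, mulLE_zero _ _ _ _ h₁ hH.1⟩
    ⟨(0, 1), one_pos, mulLE_zero _ _ _ _ h₂ hH.1⟩ ?_
  rintro ⟨p, q⟩ ⟨hq, hp⟩ ⟨p', q'⟩ ⟨hq', hp'⟩
  rw [stDiv_eq]
  refine le_iSup₂_of_le (p * q' + p' * q, q * q')
    ⟨Nat.mul_pos hq hq', mulLE_of_card p q p' q' w a w₁ a₁ w₂ a₂ H h h₁ h₂ hw₁ hw₂ hp hp'⟩ ?_
  simp only at hq hq' ⊢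
  push_cast
  rw [ENNReal.add_div, ENNReal.mul_div_mul_right _ _ (by simp [hq'.ne']) (by simp),
    mul_comm (p' : ℝ≥0∞), ENNReal.mul_div_mul_left _ _ (by simp [hq.ne']) (by simp)]

/-! ## Internal subsets of `Ω` -/

theorem mem_Omega {H x : U.Obj} : x ∈ Omega H ↔
    Mem x (U.star V.natSet) ∧ LE' (U.star (V.nat 1)) x ∧ LE' x H := by
  rw [Omega, Set.mem_ofPred_eq, le_iff, le_iff]
  rfl

theorem exists_ext_eq_Omega {H : U.Obj} (hH : U.IsHyperfinite H) :
    ∃ w, FinMap Finset.card w H ∧ ext w = Omega H := by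
  obtain ⟨w, _, hw, h₁, h₂⟩ := exists_card_Icc H hH.1
  refine ⟨w, hw, Set.ext fun x => ?_⟩
  rw [mem_Omega]
  exact ⟨h₁ x, fun h => h₂ x h.1 h.2.1 h.2.2⟩

/-- The subset `A` of `Ω` is internal. -/
def IsInternalSubset {H : U.Obj} (A : Set (Omega H)) : Prop :=
  ∃ w : U.Obj, ext w = Subtype.val '' A

variable {H : U.Obj}

theorem IsInternalSubset.isInternal {A : Set (Omega H)} (hA : IsInternalSubset A) :
    IsInternal (Subtype.val '' A) := hA.imp fun _ h => h.symm

theorem mem_iff_of_ext_eq {A : Set (Omega H)} {w : U.Obj} (h : ext w = Subtype.val '' A)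
    (x : Omega H) : Mem x.1 w ↔ x ∈ A := by
  change x.1 ∈ ext w ↔ _
  rw [h, Subtype.val_injective.mem_set_image]

theorem mem_Omega_of_ext_eq {A : Set (Omega H)} {w : U.Obj} (h : ext w = Subtype.val '' A)
    {x : U.Obj} (hx : Mem x w) : x ∈ Omega H := by
  change x ∈ ext w at hx
  rw [h] at hx
  obtain ⟨y, _, rfl⟩ := hx
  exact y.2

theorem exists_card_of_inter {A B : Set (Omega H)} {w a : U.Obj} (hw : ext w = Subtype.val '' A)
    (ha : FinMap Finset.card w a) (hB : IsInternalSubset B) :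
    ∃ w' a', ext w' = Subtype.val '' (A ∩ B) ∧ FinMap Finset.card w' a' := by
  obtain ⟨s, hs⟩ := hB
  obtain ⟨w', _, a', _, ha', h₁, h₂⟩ := exists_card_inter w a s ha
  refine ⟨w', a', Set.ext fun x => ⟨fun hx => ?_, ?_⟩, ha'⟩
  · have := h₁ x hx
    refine ⟨⟨x, mem_Omega_of_ext_eq hw this.1⟩, ⟨?_, ?_⟩, rfl⟩
    · exact (mem_iff_of_ext_eq hw ⟨x, _⟩).1 this.1
    · exact (mem_iff_of_ext_eq hs ⟨x, _⟩).1 this.2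
  · rintro ⟨x, ⟨hxA, hxB⟩, rfl⟩
    exact h₂ _ ((mem_iff_of_ext_eq hw x).2 hxA) ((mem_iff_of_ext_eq hs x).2 hxB)

theorem exists_card_of_diff {A B : Set (Omega H)} {w a : U.Obj} (hw : ext w = Subtype.val '' A)
    (ha : FinMap Finset.card w a) (hB : IsInternalSubset B) :
    ∃ w' a', ext w' = Subtype.val '' (A \ B) ∧ FinMap Finset.card w' a' := by
  obtain ⟨s, hs⟩ := hB
  obtain ⟨w', _, a', _, ha', h₁, h₂⟩ := exists_card_diff w a s ha
  refine ⟨w', a', Set.ext fun x => ⟨fun hx => ?_, ?_⟩, ha'⟩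
  · have := h₁ x hx
    refine ⟨⟨x, mem_Omega_of_ext_eq hw this.1⟩, ⟨?_, fun h => ?_⟩, rfl⟩
    · exact (mem_iff_of_ext_eq hw ⟨x, _⟩).1 this.1
    · exact this.2 ((mem_iff_of_ext_eq hs ⟨x, _⟩).2 h)
  · rintro ⟨x, ⟨hxA, hxB⟩, rfl⟩
    exact h₂ _ ((mem_iff_of_ext_eq hw x).2 hxA) (mt (mem_iff_of_ext_eq hs x).1 hxB)

theorem exists_card_univ (hH : U.IsHyperfinite H) :
    ∃ w, ext w = Subtype.val '' (Set.univ : Set (Omega H)) ∧ FinMap Finset.card w H := by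
  obtain ⟨w, hw, h⟩ := exists_ext_eq_Omega hH
  exact ⟨w, by rw [h, Set.image_univ, Subtype.range_coe], hw⟩

theorem IsInternalSubset.exists_card (hH : U.IsHyperfinite H) {A : Set (Omega H)}
    (hA : IsInternalSubset A) : ∃ w a, ext w = Subtype.val '' A ∧ FinMap Finset.card w a := by
  obtain ⟨w, hw, h⟩ := exists_card_univ hH
  simpa using exists_card_of_inter hw h hA

theorem IsInternalSubset.compl (hH : U.IsHyperfinite H) {A : Set (Omega H)}
    (hA : IsInternalSubset A) : IsInternalSubset Aᶜ := by
  obtain ⟨w, hw, h⟩ := exists_card_univ hH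
  obtain ⟨w', _, hw', _⟩ := exists_card_of_diff hw h hA
  exact ⟨w', by rw [hw', Set.compl_eq_univ_sdiff]⟩

theorem isInternalSubset_empty (hH : U.IsHyperfinite H) :
    IsInternalSubset (∅ : Set (Omega H)) := by
  obtain ⟨w, hw, _⟩ := exists_card_univ hH
  have := IsInternalSubset.compl hH ⟨w, hw⟩
  rwa [Set.compl_univ] at this

/-- Internal subsets of Ω are hyperfinite, and the nonstandard extension of an injective coding of
finite sets of naturals sends them injectively into the hypernaturals. -/
theorem mk_isInternalSubset_le (hH : U.IsHyperfinite H) :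
    #{A : Set (Omega H) // IsInternalSubset A} ≤ #U.hypernat := by
  have key : ∀ A : {A : Set (Omega H) // IsInternalSubset A}, ∃ k : U.hypernat,
      ∃ w, ext w = Subtype.val '' A.1 ∧ FinMap Encodable.encode w k.1 := by
    rintro ⟨A, hA⟩
    obtain ⟨w, a, hw, ha⟩ := hA.exists_card hH
    obtain ⟨k, hk, hk'⟩ := exists_finMap _ Encodable.encode w a ha
    exact ⟨⟨k, hk⟩, w, hw, hk'⟩
  choose f w hw hf using key
  refine mk_le_of_injective (f := f) fun A B h => ?_
  have := finMap_injective Encodable.encode_injective _ _ _ (hf A) (h ▸ hf B)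
  refine Subtype.ext (Subtype.val_injective.image_injective ?_)
  rw [← hw, ← hw, this]

/-! ## The Loeb measure -/

theorem stP_le {A : Set (Omega H)} {w a : U.Obj} (hw : ext w = Subtype.val '' A)
    (ha : FinMap Finset.card w a) : stP H A ≤ stDiv a H :=
  iInf₂_le_of_le w hw (iInf₂_le a (isCard_iff.2 ha))

theorem isInternalSubset_of_stP_ne_top {A : Set (Omega H)} (h : stP H A ≠ ∞) :
    IsInternalSubset A := by
  by_contra hn
  refine h (iInf₂_eq_top.2 fun w hw => ?_)
  exact absurd ⟨w, hw⟩ hn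

/-- Carathéodory's criterion need only be checked for `stP` on test sets. A test set that is not
internal has `stP` equal to `∞`, and on internal ones superadditivity of `stDiv` suffices. -/
theorem IsInternalSubset.measurableSet (hH : U.IsHyperfinite H) {A : Set (Omega H)}
    (hA : IsInternalSubset A) : MeasurableSet A := by
  refine OuterMeasure.boundedBy_caratheodory fun t => ?_
  refine le_iInf₂ fun w hw => le_iInf₂ fun a ha => ?_
  rw [isCard_iff] at ha
  obtain ⟨w₁, a₁, hw₁, ha₁⟩ := exists_card_of_inter hw ha hA
  obtain ⟨w₂, a₂, hw₂, ha₂⟩ := exists_card_of_diff hw ha hA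
  refine (add_le_add (stP_le hw₁ ha₁) (stP_le hw₂ ha₂)).trans
    (stDiv_add_le hH ha ha₁ ha₂ (fun x hx => ?_) fun x hx => ?_)
  · exact (mem_iff_of_ext_eq hw ⟨x, mem_Omega_of_ext_eq hw₁ hx⟩).2
      ((mem_iff_of_ext_eq hw₁ ⟨x, _⟩).1 hx).1
  · have h := (mem_iff_of_ext_eq hw₂ ⟨x, mem_Omega_of_ext_eq hw₂ hx⟩).1 hx
    exact ⟨(mem_iff_of_ext_eq hw ⟨x, _⟩).2 h.1,
      fun hx' => h.2 ((mem_iff_of_ext_eq hw₁ ⟨x, mem_Omega_of_ext_eq hw₂ hx⟩).1 hx').2⟩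

/-- This upper bound is all that the argument uses; equality on internal sets is never needed. -/
theorem loebMeasure_le_stP {A : Set (Omega H)} (hA : MeasurableSet A) :
    loebMeasure H A ≤ stP H A := by
  rw [loebMeasure, toMeasure_apply _ _ hA]
  exact OuterMeasure.boundedBy_le _

theorem loebMeasure_univ_lt_top (hH : U.IsHyperfinite H) :
    loebMeasure H Set.univ < ∞ := by
  obtain ⟨w, hw, h⟩ := exists_card_univ hH
  refine ((loebMeasure_le_stP MeasurableSet.univ).trans
    ((stP_le hw h).trans (stDiv_le hH one_pos (mulLE_refl 1 H hH.1)))).trans_lt ?_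
  simp

/-- Every measurable set is covered by countably many internal sets of almost the same total
measure. -/
theorem exists_internal_cover (hH : U.IsHyperfinite H) {A : Set (Omega H)}
    (hA : MeasurableSet A) {ε : ℝ≥0∞} (hε : ε ≠ 0) :
    ∃ B : ℕ → Set (Omega H), (∀ n, IsInternalSubset (B n)) ∧ A ⊆ ⋃ n, B n ∧
      ∑' n, loebMeasure H (B n) ≤ loebMeasure H A + ε := by
  have hfin : loebMeasure H A ≠ ∞ :=
    ((measure_mono (Set.subset_univ A)).trans_lt (loebMeasure_univ_lt_top hH)).ne
  have h := ENNReal.lt_add_right hfin hε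
  conv_lhs at h => rw [loebMeasure, toMeasure_apply _ _ hA, loebOuter, OuterMeasure.boundedBy_apply]
  simp only [iInf_lt_iff] at h
  obtain ⟨B, hAB, hB⟩ := h
  have hint : ∀ n, IsInternalSubset (B n) := by
    intro n
    rcases (B n).eq_empty_or_nonempty with h | h
    · rw [h]
      exact isInternalSubset_empty hH
    -- A cover of finite total weight has only internal nonempty members, since `stP` is `∞`
    -- elsewhere.
    · refine isInternalSubset_of_stP_ne_top (ne_of_lt ?_)
      have := (ENNReal.le_tsum n).trans_lt hB
      rw [iSup_pos h] at this
      exact this.trans_le le_top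
  refine ⟨B, hint, hAB, le_trans (ENNReal.tsum_le_tsum fun n => ?_) hB.le⟩
  rcases (B n).eq_empty_or_nonempty with h | h
  · simp [h]
  · rw [iSup_pos h]
    exact loebMeasure_le_stP ((hint n).measurableSet hH)

/-! ## Digits of hypernatural numbers -/

/-- The hypernatural numbers `i` with `(n + 2) ^ (i + 1) ≤ H`. -/
def digitIndex (H : U.Obj) (n : ℕ) : Set U.Obj := {i | Op (digitGuard n) i H (U.star (V.nat 1))}

/-- The set of places is internal and infinite. Were it smaller than `lam`, saturation would give a
place lying in every internal set obtained by deleting a single place, hence different from itself.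
-/
theorem le_mk_digitIndex (hH : U.IsHyperfinite H) {lam : Cardinal.{u}} (hsat : U.IsSaturated lam)
    (n : ℕ) : lam ≤ #(digitIndex H n) := by
  by_contra! hlt
  have key : ∀ i : digitIndex H n, ∃ w, ∀ x, Mem x w ↔ x ∈ digitIndex H n ∧ x ≠ i.1 := by
    intro i
    obtain ⟨w, _, h₁, h₂⟩ := exists_digitGuard_ne n H i.1 hH.1
    exact ⟨w, fun x => ⟨h₁ x, fun h => h₂ x (op_range _ _ _ _ h.1).1 h.1 h.2⟩⟩
  choose w hw using key
  have hnat : ∀ m, U.star (V.nat m) ∈ digitIndex H n := fun m =>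
    digitGuard_nat n m H (hH.star_le _)
  obtain ⟨x, hx⟩ := hsat (Set.range fun i => ext (w i))
    (by rintro _ ⟨i, rfl⟩; exact ⟨_, rfl⟩) (mk_range_le.trans_lt hlt) (by
      intro F hF hfin
      have hsub : ∀ A ∈ F, {m : ℕ | U.star (V.nat m) ∉ A}.Finite := by
        intro A hA
        obtain ⟨i, rfl⟩ := hF hA
        refine Set.Subsingleton.finite fun m hm k hk => ?_
        have : ∀ m, U.star (V.nat m) ∉ ext (w i) → U.star (V.nat m) = i.1 := fun m hm => by
          by_contra hne
          exact hm ((hw i _).2 ⟨hnat m, hne⟩)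
        exact star_nat_injective ((this m hm).trans (this k hk).symm)
      -- Each set misses at most one standard place, so some standard place lies in all of the
      -- finitely many.
      obtain ⟨m, hm⟩ := (hfin.biUnion hsub).infinite_compl.nonempty
      refine ⟨U.star (V.nat m), fun A hA => ?_⟩
      by_contra hmA
      exact hm (Set.mem_biUnion hA hmA))
  have h₀ := (hw ⟨_, hnat 0⟩ x).1 (hx _ ⟨_, rfl⟩)
  exact ((hw ⟨x, h₀.1⟩ x).1 (hx _ ⟨_, rfl⟩)).2 rfl

/-- The base is standard, so every digit is bounded by a standard number and is itself standard. -/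
theorem exists_digit_eq (n : ℕ) (i : digitIndex H n) (x : Omega H) :
    ∃ t : Fin (n + 2), Op (digit n) i.1 x.1 (U.star (V.nat t)) := by
  obtain ⟨t, _, ht, hle⟩ := exists_digit n i.1 x.1 (op_range _ _ _ _ i.2).1 x.2.1
  obtain ⟨k, hk, rfl⟩ := exists_eq_star_of_le _ hle
  exact ⟨⟨k, by omega⟩, ht⟩

/-- The digit of `x ∈ Ω` at the place `i` in base `n + 2`. -/
noncomputable def hyperdigit (n : ℕ) (i : digitIndex H n) (x : Omega H) : Fin (n + 2) :=
  (exists_digit_eq n i x).choose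

theorem hyperdigit_spec (n : ℕ) (i : digitIndex H n) (x : Omega H) :
    Op (digit n) i.1 x.1 (U.star (V.nat (hyperdigit n i x))) :=
  (exists_digit_eq n i x).choose_spec

theorem hyperdigit_eq_iff {n : ℕ} {i j : digitIndex H n} {x : Omega H} :
    hyperdigit n i x = hyperdigit n j x ↔
      ∃ t, Mem t (U.star V.natSet) ∧ Op (digit n) i.1 x.1 t ∧ Op (digit n) j.1 x.1 t := by
  constructor
  · intro h
    have hi := hyperdigit_spec n i x
    have hj := hyperdigit_spec n j x
    rw [← h] at hj
    exact ⟨_, (op_range _ _ _ _ hi).2, hi, hj⟩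
  · rintro ⟨t, _, hi, hj⟩
    refine Fin.ext (star_nat_injective (U := U) ?_)
    exact (op_unique _ _ _ _ _ (hyperdigit_spec n i x) hi).trans
      (op_unique _ _ _ _ _ (hyperdigit_spec n j x) hj).symm

theorem hyperdigit_eq_internal (hH : U.IsHyperfinite H) {n : ℕ} {i j : digitIndex H n}
    (hij : i ≠ j) : IsInternalSubset {x | hyperdigit n i x = hyperdigit n j x} ∧
      loebMeasure H {x | hyperdigit n i x = hyperdigit n j x} ≤ 3 / ((n + 2 : ℕ) : ℝ≥0∞) := by
  obtain ⟨w, _, a, _, ha, hle, h₁, h₂⟩ := exists_sameDigit n H i.1 j.1 j.2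
    (op_range _ _ _ _ i.2).1 (fun h => hij (Subtype.ext h))
  have hw : ext w = Subtype.val '' {x : Omega H | hyperdigit n i x = hyperdigit n j x} := by
    ext x
    constructor
    · intro hx
      have := h₁ x hx
      exact ⟨⟨x, mem_Omega.2 ⟨this.1, this.2.1, this.2.2.1⟩⟩, hyperdigit_eq_iff.2 this.2.2.2, rfl⟩
    · rintro ⟨x, hx, rfl⟩
      have := mem_Omega.1 x.2
      exact h₂ _ this.1 this.2.1 this.2.2 (hyperdigit_eq_iff.1 hx)
  have hint : IsInternalSubset {x : Omega H | hyperdigit n i x = hyperdigit n j x} := ⟨w, hw⟩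
  refine ⟨hint, (loebMeasure_le_stP (hint.measurableSet hH)).trans ((stP_le hw ha).trans ?_)⟩
  exact stDiv_le hH (Nat.succ_pos _) hle

end NonstandardUniverse

/-! ## A combinatorial lemma on strong limit cardinals of cofinality `ω` -/

/-- A set of size at most `κ` is a countable union of sets of size less than `κ` if `κ` has
cofinality `ω`. -/
theorem exists_eq_iUnion_mk_lt {κ : Cardinal.{u}} (hκ : ℵ₀ ≤ κ) (hcof : κ.ord.cof = ℵ₀)
    {X : Type u} {P : Set X} (hP : #P ≤ κ) :
    ∃ Q : ℕ → Set X, (∀ m, #(Q m) < κ) ∧ P ⊆ ⋃ m, Q m := by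
  obtain ⟨s, hs, hs'⟩ := Order.exists_cof_eq κ.ord.ToType
  rw [Ordinal.cof_toType, hcof] at hs'
  have : Countable s := mk_le_aleph0_iff.1 hs'.le
  have : Nonempty s := mk_ne_zero_iff.1 (by rw [hs']; exact aleph0_ne_zero)
  obtain ⟨g, hg⟩ := exists_surjective_nat s
  obtain ⟨f⟩ : Nonempty (P ↪ κ.ord.ToType) := by
    rwa [← le_def, mk_ord_toType]
  -- The pieces are initial segments cut at the points of a countable cofinal subset of κ.
  refine ⟨fun m => Subtype.val '' (f ⁻¹' Set.Iic (g m).1), fun m => ?_, fun x hx => ?_⟩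
  · refine mk_image_le.trans_lt ((mk_preimage_of_injective _ _ f.injective).trans_lt ?_)
    have h₁ : #(Set.Iio (g m).1) < κ := by simpa using mk_Iio_lt (g m).1
    rw [← Set.Iio_insert]
    exact mk_insert_le.trans_lt (add_lt_of_lt hκ h₁ (one_lt_aleph0.trans_le hκ))
  · obtain ⟨b, hb, hle⟩ := hs (f ⟨x, hx⟩)
    obtain ⟨m, hm⟩ := hg ⟨b, hb⟩
    exact Set.mem_iUnion.2 ⟨m, ⟨x, hx⟩, by simpa [hm] using hle, rfl⟩

/-- The strong limit hypothesis enters here, through `2 ^ #P < κ`; for infinite `P` the finite base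
makes no difference. -/
theorem mk_pi_fin_lt {κ : Cardinal.{u}} (hκ : κ.IsStrongLimit) {P : Type u} (hP : #P < κ)
    (n : ℕ) : #(P → Fin (n + 2)) < κ := by
  simp only [mk_pi, mk_fin, prod_const, lift_natCast, lift_uzero]
  rcases lt_or_ge #P ℵ₀ with h | h
  · exact (power_lt_aleph0 (natCast_lt_aleph0) h).trans_le hκ.aleph0_le
  · rw [nat_power_eq h (by omega)]
    exact hκ.isStrongPrelimit hP

theorem exists_nat_div_le {ε : ℝ≥0∞} (hε : 0 < ε) : ∃ n : ℕ, 3 / ((n + 2 : ℕ) : ℝ≥0∞) ≤ ε := by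
  obtain ⟨n, hn⟩ :=
    ENNReal.exists_nat_gt (ENNReal.div_ne_top (ENNReal.ofNat_ne_top (n := 3)) hε.ne')
  refine ⟨n, ENNReal.div_le_of_le_mul ?_⟩
  have h : 3 ≤ (n : ℝ≥0∞) * ε :=
    (ENNReal.div_le_iff_le_mul (.inl hε.ne') (.inr fun h => by simp [h] at hn)).1 hn.le
  rw [mul_comm]
  refine h.trans ?_
  gcongr
  simp

/-- The points of a set of size at most `κ` satisfy one of countably many coincidences of
coordinates, of small total weight. -/
theorem exists_coincidences {κ : Cardinal.{u}} (hκ : κ.IsStrongLimit) (hcof : κ.ord.cof = ℵ₀)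
    {P : Set (∀ n : ℕ, κ.out → Fin (n + 2))} (hP : #P ≤ κ) {ε : ℝ≥0∞} (hε : ε ≠ 0) :
    ∃ (n : ℕ → ℕ) (i j : ℕ → κ.out), (∀ m, i m ≠ j m) ∧
      ∑' m, 3 / ((n m + 2 : ℕ) : ℝ≥0∞) ≤ ε ∧ ∀ x ∈ P, ∃ m, x (n m) (i m) = x (n m) (j m) := by
  obtain ⟨δ, hδ, hsum⟩ := ENNReal.exists_pos_sum_of_countable' hε ℕ
  choose n hn using fun m => exists_nat_div_le (hδ m)
  obtain ⟨Q, hQ, hPQ⟩ := exists_eq_iUnion_mk_lt hκ.aleph0_le hcof hP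
  have key : ∀ m, ∃ i j : κ.out, i ≠ j ∧ ∀ x ∈ Q m, x (n m) i = x (n m) j := by
    intro m
    -- Pigeonhole: κ coordinates restrict to fewer than κ functions on `Q m`.
    by_contra! hne
    have hinj : Function.Injective fun (i : κ.out) (x : Q m) => x.1 (n m) i := by
      intro i j hij
      by_contra h
      obtain ⟨x, hx, hx'⟩ := hne i j h
      exact hx' (congrFun hij ⟨x, hx⟩)
    have h := mk_le_of_injective hinj
    rw [mk_out] at h
    exact h.not_gt (mk_pi_fin_lt hκ (hQ m) (n m))
  choose i j hij hx using key
  refine ⟨n, i, j, hij, (ENNReal.tsum_le_tsum hn).trans hsum.le, fun x hxP => ?_⟩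
  obtain ⟨m, hm⟩ := Set.mem_iUnion.1 (hPQ hxP)
  exact ⟨m, hx m x hm⟩

theorem mk_pi_pi_fin_le {κ : Cardinal.{u}} (hκ : ℵ₀ ≤ κ) :
    #(∀ n : ℕ, κ.out → Fin (n + 2)) ≤ 2 ^ κ := by
  have hinj : Function.Injective fun (x : ∀ n : ℕ, κ.out → Fin (n + 2)) (p : ℕ × κ.out) =>
      (x p.1 p.2 : ℕ) := by
    intro x y h
    funext n i
    exact Fin.ext (congrFun h (n, i))
  refine (mk_le_of_injective hinj).trans ?_
  simp only [mk_pi, prod_const, mk_prod, mk_nat, lift_aleph0, lift_uzero, mk_out]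
  rw [aleph0_mul_eq hκ, power_eq_two_power hκ (natCast_lt_aleph0 (n := 2)).le hκ]

/-- There are countable systems of coincidences, indexed by a set of size at most `2 ^ κ = κ⁺`,
such that no point escapes more than `κ` of them, and finitely many witness this. -/
theorem exists_coincidence_systems {κ : Cardinal.{u}} (hκ : κ.IsStrongLimit)
    (hcof : κ.ord.cof = ℵ₀) (hpow : 2 ^ κ = Order.succ κ) {I : Type u} (hI : #I ≤ 2 ^ κ)
    {ε : I → ℝ≥0∞} (hε : ∀ c, ε c ≠ 0) :
    ∃ (n : I → ℕ → ℕ) (i j : I → ℕ → κ.out), (∀ c m, i c m ≠ j c m) ∧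
      (∀ c, ∑' m, 3 / ((n c m + 2 : ℕ) : ℝ≥0∞) ≤ ε c) ∧
      ∀ S : Set I, ¬ #S ≤ κ → ∃ F : Finset I, ↑F ⊆ S ∧
        ∀ x : ∀ n : ℕ, κ.out → Fin (n + 2), ∃ c ∈ F, ∃ m,
          x (n c m) (i c m) = x (n c m) (j c m) := by
  obtain ⟨r⟩ : Nonempty (I ↪ (Order.succ κ).ord.ToType) := by
    rwa [← le_def, mk_ord_toType, ← hpow]
  obtain ⟨s⟩ : Nonempty ((∀ n : ℕ, κ.out → Fin (n + 2)) ↪ (Order.succ κ).ord.ToType) := by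
    rw [← le_def, mk_ord_toType, ← hpow]
    exact mk_pi_pi_fin_le hκ.aleph0_le
  have hIio : ∀ a : (Order.succ κ).ord.ToType, #(Set.Iio a) ≤ κ := fun a =>
    Order.lt_succ_iff.1 (by simpa using mk_Iio_lt a)
  -- The diagonal choice: `c` takes care of the points enumerated before it.
  choose n i j hij hsum hx using fun c => exists_coincidences hκ hcof (P := s ⁻¹' Set.Iio (r c))
    ((mk_preimage_of_injective _ _ s.injective).trans (hIio _)) (hε c)
  refine ⟨n, i, j, hij, hsum, fun S hS => ?_⟩
  have hcl : ∀ c : S, IsClosed {x : ∀ n : ℕ, κ.out → Fin (n + 2) |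
      ∀ m, x (n c m) (i c m) ≠ x (n c m) (j c m)} := by
    intro c
    rw [Set.ofPred_forall]
    refine isClosed_iInter fun m => ?_
    have hcont : Continuous fun x : ∀ n : ℕ, κ.out → Fin (n + 2) =>
        (x (n c m) (i c m), x (n c m) (j c m)) := by fun_prop
    exact (isClosed_discrete {p : Fin (n c m + 2) × Fin (n c m + 2) | p.1 ≠ p.2}).preimage hcont
  -- The product of finite discrete spaces is compact, and avoiding coincidences is a closed
  -- condition. A point avoiding all of `S` would bound the ranks of `S` by its own rank, leaving at
  -- most κ indices.
  obtain ⟨F, hF⟩ := isCompact_univ.elim_finite_subfamily_closed _ hcl (by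
    rw [Set.univ_inter, Set.eq_empty_iff_forall_notMem]
    intro x hxS
    refine hS ?_
    have hsub : S ⊆ r ⁻¹' Set.Iic (s x) := by
      intro c hc
      by_contra hlt
      have hlt' : s x < r c := lt_of_not_ge fun h => hlt h
      obtain ⟨m, hm⟩ := hx c x hlt'
      exact Set.mem_iInter.1 hxS ⟨c, hc⟩ m hm
    refine (mk_le_mk_of_subset hsub).trans
      ((mk_preimage_of_injective _ _ r.injective).trans ?_)
    rw [← Set.Iio_insert]
    exact mk_insert_le.trans ((add_le_add_left (hIio _) 1).trans
      (add_one_eq hκ.aleph0_le).le))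
  refine ⟨F.map (Function.Embedding.subtype _), fun c hc => ?_, fun x => ?_⟩
  · obtain ⟨c, _, rfl⟩ := Finset.mem_map.1 (Finset.mem_coe.1 hc)
    exact c.2
  · by_contra! hne
    refine Set.eq_empty_iff_forall_notMem.1 hF x ⟨trivial, Set.mem_iInter₂.2 fun c hc m => ?_⟩
    exact hne c (Finset.mem_map_of_mem _ hc) m

/-! ### Compactness of the Loeb measure. -/

namespace NonstandardUniverse

variable {U : NonstandardUniverse.{u}} {H : U.Obj}

/-- Countable intersections of internal sets: a family of fewer than `lam` of them which has the
finite intersection property has nonempty intersection. -/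
theorem IsSaturated.sInter_nonempty {κ : Cardinal.{u}} (hκ : ℵ₀ ≤ κ)
    (hsat : U.IsSaturated (Order.succ κ)) {I : Type u} {Z : I → ℕ → Set (Omega H)}
    (hZ : ∀ c m, IsInternalSubset (Z c m)) {S : Set I} (hS : #S ≤ κ)
    (hfip : HasFIP ((fun c => ⋂ m, Z c m) '' S)) :
    (⋂₀ ((fun c => ⋂ m, Z c m) '' S)).Nonempty := by
  rcases S.eq_empty_or_nonempty with rfl | ⟨c₀, hc₀⟩
  · exact hfip _ subset_rfl (by simp)
  let D : Set (Set U.Obj) := Set.range fun p : S × ℕ => Subtype.val '' Z p.1 p.2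
  obtain ⟨x, hx⟩ := hsat D (by rintro _ ⟨p, rfl⟩; exact (hZ _ _).isInternal) (by
    have h : #(S × ℕ) ≤ κ := by
      rw [mk_prod, lift_uzero, mk_nat, lift_aleph0]
      exact mul_le_of_le hκ hS hκ
    exact Order.lt_succ_iff.2 (mk_range_le.trans h)) (by
    intro F hF hfin
    have : Nonempty (S × ℕ) := ⟨(⟨c₀, hc₀⟩, 0)⟩
    have hF' : ∀ A ∈ F, ∃ p : S × ℕ, Subtype.val '' Z p.1 p.2 = A := fun A hA => hF hA
    choose! p hp using hF'
    -- Each chosen `Z` contains the countable intersection with the same index, so finite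
    -- intersection passes to the individual internal sets.
    obtain ⟨x, hx⟩ := hfip ((fun A => ⋂ m, Z (p A).1 m) '' F)
      (by rintro _ ⟨A, hA, rfl⟩; exact ⟨_, (p A).1.2, rfl⟩) (hfin.image _)
    refine ⟨x.1, fun A hA => ?_⟩
    rw [← hp A hA]
    exact ⟨x, Set.mem_iInter.1 (hx _ ⟨A, hA, rfl⟩) _, rfl⟩)
  -- Membership in one of the internal sets places the point in Ω.
  obtain ⟨y, -, rfl⟩ := hx _ ⟨(⟨c₀, hc₀⟩, 0), rfl⟩
  refine ⟨y, ?_⟩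
  rintro _ ⟨c, hc, rfl⟩
  refine Set.mem_iInter.2 fun m => ?_
  exact Subtype.val_injective.mem_set_image.1 (hx _ ⟨(⟨c, hc⟩, m), rfl⟩)

end NonstandardUniverse

open NonstandardUniverse

/-- Let `κ` be a strong limit cardinal of cofinality `ω` with `2 ^ κ = κ⁺`. In a `κ⁺`-saturated
nonstandard universe with at most `2 ^ κ` hypernatural numbers, hyperfinite Loeb spaces are
compact. -/
theorem isCompactMeasure_loebMeasure {κ : Cardinal.{u}} (hκ : κ.IsStrongLimit)
    (hcof : κ.ord.cof = ℵ₀) (hpow : 2 ^ κ = Order.succ κ) {U : NonstandardUniverse.{u}}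
    (hsat : U.IsSaturated (Order.succ κ)) (hcard : #U.hypernat ≤ 2 ^ κ) {H : U.Obj}
    (hH : U.IsHyperfinite H) : IsCompactMeasure (loebMeasure H) := by
  have hindex : ∀ n, Nonempty (κ.out ↪ digitIndex H n) := fun n => by
    rw [← le_def, mk_out]
    exact (Order.le_succ κ).trans (le_mk_digitIndex hH hsat n)
  let e := fun n => (hindex n).some
  -- The sequence is a potential cover of a complement; the number fixes how much measure the
  -- coincidences may cost.
  let I : Type u := (ℕ → {A : Set (Omega H) // IsInternalSubset A}) × ℕ
  have hI : #I ≤ 2 ^ κ := by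
    have h₁ : #(ℕ → {A : Set (Omega H) // IsInternalSubset A}) ≤ 2 ^ κ := by
      simp only [mk_pi, prod_const, mk_nat, lift_aleph0, lift_uzero]
      refine (power_le_power_right ((mk_isInternalSubset_le hH).trans hcard)).trans_eq ?_
      rw [← power_mul, mul_aleph0_eq hκ.aleph0_le]
    rw [mk_prod, lift_uzero, mk_nat, lift_aleph0]
    have h₂ : ℵ₀ ≤ (2 : Cardinal.{u}) ^ κ := hκ.aleph0_le.trans (cantor κ).le
    exact mul_le_of_le h₂ h₁ h₂
  obtain ⟨n, i, j, hij, hsum, hS⟩ := exists_coincidence_systems hκ hcof hpow hI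
    (ε := fun c => ((c.2 : ℝ≥0∞) + 1)⁻¹) (by simp)
  let Y : I → ℕ → Set (Omega H) := fun c m =>
    {x | hyperdigit (n c m) (e _ (i c m)) x = hyperdigit (n c m) (e _ (j c m)) x}
  have hY : ∀ c m, IsInternalSubset (Y c m) ∧
      loebMeasure H (Y c m) ≤ 3 / ((n c m + 2 : ℕ) : ℝ≥0∞) := fun c m =>
    hyperdigit_eq_internal hH ((e _).injective.ne (hij c m))
  let W : I → ℕ ⊕ ℕ → Set (Omega H) := fun c => Sum.elim (fun m => (c.1 m).1) (Y c)
  have hW : ∀ c k, IsInternalSubset (W c k) := by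
    rintro c (m | m)
    · exact (c.1 m).2
    · exact (hY c m).1
  let K : I → Set (Omega H) := fun c => ⋂ k, (W c k)ᶜ
  have hK : ∀ c, MeasurableSet (K c) := fun c =>
    MeasurableSet.iInter fun k => ((hW c k).measurableSet hH).compl
  refine ⟨Set.range K, ?_, fun D hD hfip => ?_, fun A hA => le_antisymm ?_ ?_⟩
  · rintro _ ⟨c, rfl⟩
    exact hK c
  · have : Nonempty I := ⟨(fun _ => ⟨∅, isInternalSubset_empty hH⟩, 0)⟩
    have hD' : ∀ A ∈ D, ∃ c, K c = A := fun A hA => hD hA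
    choose! c hc using hD'
    have hDc : D = K '' (c '' D) := by
      ext A
      rw [Set.image_image]
      exact ⟨fun hA => ⟨A, hA, hc A hA⟩, by
        rintro ⟨B, hB, rfl⟩
        exact Set.mem_of_eq_of_mem (hc B hB) hB⟩
    -- Few indices are handled by saturation; too many contradict the finite intersection property.
    by_cases hle : #(c '' D) ≤ κ
    · let f := Equiv.natSumNatEquivNat.symm
      have hKf : K = fun c => ⋂ m, (W c (f m))ᶜ := by
        funext c
        exact (f.surjective.iInter_comp fun k => (W c k)ᶜ).symm
      rw [hDc, hKf] at hfip ⊢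
      exact hsat.sInter_nonempty hκ.aleph0_le (fun c m => (hW c (f m)).compl hH) hle hfip
    · exfalso
      obtain ⟨F, hF, hF'⟩ := hS _ hle
      obtain ⟨x, hx⟩ := hfip (K '' F) (by rw [hDc]; exact Set.image_mono hF)
        (F.finite_toSet.image K)
      -- The digits of `x` form a point of the product, and a coincidence there puts `x` in some `Y
      -- d m`, which `K d` excludes.
      obtain ⟨d, hd, m, hm⟩ := hF' fun n k => hyperdigit n (e n k) x
      exact Set.mem_iInter.1 (hx _ ⟨d, hd, rfl⟩) (.inr m) hm
  · refine ENNReal.le_of_forall_pos_le_add fun ε hε _ => ?_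
    have hε' : (ε : ℝ≥0∞) / 2 ≠ 0 := by simp [hε.ne']
    obtain ⟨B, hB, hAB, hBsum⟩ := exists_internal_cover hH hA.compl hε'
    obtain ⟨N, hN⟩ := ENNReal.exists_inv_nat_lt hε'
    let c : I := (fun m => ⟨B m, hB m⟩, N)
    have hKA : K c ⊆ A := by
      intro x hx
      by_contra hxA
      obtain ⟨m, hm⟩ := Set.mem_iUnion.1 (hAB hxA)
      exact Set.mem_iInter.1 hx (.inl m) hm
    -- Half of `ε` pays for the cover of the complement of `A`, the other half for the coincidences,
    -- as `1 / (N + 1) ≤ 1 / N < ε / 2`.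
    have hcompl : loebMeasure H (K c)ᶜ ≤ loebMeasure H Aᶜ + ε := by
      rw [Set.compl_iInter]
      simp only [compl_compl]
      refine (measure_iUnion_le _).trans ?_
      rw [ENNReal.summable.tsum_sum ENNReal.summable]
      refine (add_le_add hBsum ((ENNReal.tsum_le_tsum fun m => (hY c m).2).trans
        ((hsum c).trans ((ENNReal.inv_le_inv.2 le_self_add).trans hN.le)))).trans ?_
      rw [add_assoc, ENNReal.add_halves]
    have hfin : ∀ s, loebMeasure H s ≠ ∞ := fun s =>
      ((measure_mono (Set.subset_univ s)).trans_lt (loebMeasure_univ_lt_top hH)).ne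
    have hle : loebMeasure H A ≤ loebMeasure H (K c) + ε := by
      refine (ENNReal.add_le_add_iff_right (hfin Aᶜ)).1 ?_
      calc loebMeasure H A + loebMeasure H Aᶜ
          = loebMeasure H (K c) + loebMeasure H (K c)ᶜ := by
            rw [measure_add_measure_compl hA, measure_add_measure_compl (hK c)]
        _ ≤ loebMeasure H (K c) + (loebMeasure H Aᶜ + ε) := by gcongr
        _ = loebMeasure H (K c) + ε + loebMeasure H Aᶜ := by ring
    refine hle.trans ?_
    gcongr
    exact le_sSup ⟨K c, ⟨c, rfl⟩, hKA, rfl⟩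
  · refine sSup_le ?_
    rintro _ ⟨C, _, hCA, rfl⟩
    exact measure_mono hCA

end LoebCompact

theorem theorem8 (κ lam : Cardinal.{u}) (hκ : κ.IsStrongLimit) (hcof : κ.ord.cof = ℵ₀)
    (hsucc : lam = Order.succ κ) (hpow : lam = 2 ^ κ)
    (U : LoebCompact.NonstandardUniverse.{u}) (hsat : U.IsSaturated lam)
    (hcard : #U.hypernat = lam) (H : U.Obj) (hH : U.IsHyperfinite H) :
    LoebCompact.IsCompactMeasure (LoebCompact.NonstandardUniverse.loebMeasure H) :=
  LoebCompact.isCompactMeasure_loebMeasure hκ hcof (hpow ▸ hsucc) (hsucc ▸ hsat)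
    (hcard.trans hpow).le hH
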